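/- **Theorem 3.9 (Gradient flow of subharmonic representatives).** Let $D\subset\mathbb{R}^d$ be a bounded open set and $$X=\{w\in H^1_0(D)\ :\ w\ge 0\ \text{a.e.},\ 1+\Delta w\ge 0\ \text{in the sense of distributions on } D\}\subset L^2(D).$$ Let $T>0$, $\lambda\in\mathbb{R}$, and let $J:L^2(D)\to\,]-\infty,+\infty]$ be a functional with effective domain $D(J)=\{w: J(w)<+\infty\}\subset X$ which is proper ($D(J)\neq\emptyset$), lower semicontinuous for the $L^2(D)$ norm, and $\lambda$-convex, that is $$J((1-t)w_0+tw_1)\le(1-t)J(w_0)+tJ(w_1)-\tfrac{\lambda}{2}t(1-t)\|w_0-w_1\|^2_{L^2(D)}\qquad\forall\, w_0,w_1\in D(J),\ t\in[0,1].$$ A curve $u:[0,T]\to L^2(D)$ is a *minimizing movement* of $J$ with initial condition $w_0$ if for all sufficiently small $\varepsilon>0$ there is a sequence $(w_\varepsilon^n)_{n\ge0}$ with $w_\varepsilon^0=w_0$ and $$w_\varepsilon^{n+1}\in\operatorname{argmin}_{v\in L^2(D)}\Big\{J(v)+\frac{1}{2\varepsilon}\|v-w_\varepsilon^n\|^2_{L^2(D)}\Big\}\qquad\forall\,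 n\ge 0,$$ such that $w_\varepsilon^{\lfloor t/\varepsilon\rfloor}\to u(t)$ in $L^2(D)$ as $\varepsilon\to0$, for every $t\in[0,T]$. The (Fréchet) subdifferential $\partial J(w)$ at $w\in D(J)$ is the set of $\xi\in L^2(D)$ with $$\liminf_{v\to w}\frac{J(v)-J(w)-\langle\xi,v-w\rangle}{\|v-w\|}\ge0,$$ and $\partial J(w)=\emptyset$ if $w\notin D(J)$. Then for every $w_0\in\overline{D(J)}$ (closure in $L^2(D)$) there exists a unique minimizing movement $w=S(w_0):[0,T]\to L^2(D)$ of $J$ with initial condition $w_0$. Moreover, $w$ is the unique solution of the gradient flow $$w'(t)+\partial J(w(t))\ni0\quad\text{for a.e. }t\in(0,T),\qquad w(0)=w_0,$$ where a solution is a curve that is continuous on $[0,T]$, locally absolutely continuous in $(0,T)$, and differentiable with $-w'(t)\in\partial J(w(t))$ at a.e. $t\in(0,T)$. Finally, $$\|S(w_0)(t)-S(v_0)(t)\|_{L^2(D)}\le e^{-\lambda t}\|w_0-v_0\|_{L^2(D)}\qquad\forall\, w_0,v_0\in\overline{D(J)},\ t\in[0,T].$$ -/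

import Mathlib

open MeasureTheory Set Filter Topology TopologicalSpace
open scoped Distributions RealInnerProductSpace Laplacian ENNReal

/-! ### Gradient flows and minimizing movements in a Hilbert space -/

/-- The effective domain `D(J)` of an extended-real functional. -/
def effDomain {H : Type*} (J : H → EReal) : Set H := {w | J w < ⊤}

/-- `J : H → ]-∞, +∞]` is proper: it never takes the value `-∞` and it is finite somewhere. -/
def IsProperFunctional {H : Type*} (J : H → EReal) : Prop :=
  (∀ w, J w ≠ ⊥) ∧ (effDomain J).Nonempty

/-- `lam`-convexity of a functional `J : H → ]-∞, +∞]` along segments. -/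
def IsLambdaConvex {H : Type*} [NormedAddCommGroup H] [InnerProductSpace ℝ H]
    (lam : ℝ) (J : H → EReal) : Prop :=
  ∀ w₀ ∈ effDomain J, ∀ w₁ ∈ effDomain J, ∀ t ∈ Icc (0 : ℝ) 1,
    J ((1 - t) • w₀ + t • w₁) ≤
      ((1 - t : ℝ) : EReal) * J w₀ + ((t : ℝ) : EReal) * J w₁
        - ((lam / 2 * t * (1 - t) * ‖w₀ - w₁‖ ^ 2 : ℝ) : EReal)

/-- The sequence `W` solves the implicit Euler scheme of time step `ε` started at `w₀`:
`W 0 = w₀` and `W (n + 1)` minimizes `v ↦ J v + ‖v - W n‖² / (2 ε)` over `H`. -/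
def IsImplicitEuler {H : Type*} [NormedAddCommGroup H] [InnerProductSpace ℝ H]
    (J : H → EReal) (ε : ℝ) (w₀ : H) (W : ℕ → H) : Prop :=
  W 0 = w₀ ∧ ∀ n, IsMinOn (fun v => J v + ((‖v - W n‖ ^ 2 / (2 * ε) : ℝ) : EReal)) univ (W (n + 1))

/-- `u` is, on `[0, T]`, a minimizing movement of `J` for the norm topology with initial
condition `w₀`: for all sufficiently small steps `ε > 0` the implicit Euler scheme has a solution
`W ε`, and the interpolations `t ↦ W ε ⌊t / ε⌋` converge to `u t` as `ε → 0`, for every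
`t ∈ [0, T]`. Only the values of `u` on `[0, T]` matter. -/
def IsMinimizingMovement {H : Type*} [NormedAddCommGroup H] [InnerProductSpace ℝ H]
    (J : H → EReal) (T : ℝ) (w₀ : H) (u : ℝ → H) : Prop :=
  ∃ W : ℝ → ℕ → H, (∀ᶠ ε in 𝓝[>] (0 : ℝ), IsImplicitEuler J ε w₀ (W ε)) ∧
    ∀ t ∈ Icc (0 : ℝ) T, Tendsto (fun ε => W ε ⌊t / ε⌋₊) (𝓝[>] (0 : ℝ)) (𝓝 (u t))

/-- The Fréchet subdifferential `∂J(w)`: the vectors `ξ` with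
`liminf_{v → w} (J v - J w - ⟪ξ, v - w⟫) / ‖v - w‖ ≥ 0`; it is empty where `J w = +∞`. -/
def frechetSubdifferential {H : Type*} [NormedAddCommGroup H] [InnerProductSpace ℝ H]
    (J : H → EReal) (w : H) : Set H :=
  {ξ | w ∈ effDomain J ∧ ∀ η > (0 : ℝ), ∀ᶠ v in 𝓝 w,
    J w + ((⟪ξ, v - w⟫ - η * ‖v - w‖ : ℝ) : EReal) ≤ J v}

/-- `w` solves the gradient flow `w' + ∂J(w) ∋ 0` a.e. in `(0, T)`, `w(0) = w₀`, in the strong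
sense: `w` is continuous on `[0, T]`, locally absolutely continuous in `(0, T)`, and at almost
every `t ∈ (0, T)` it is differentiable with `-w'(t) ∈ ∂J(w(t))`.
Only the values of `w` on `[0, T]` matter. -/
def IsGradientFlowSolution {H : Type*} [NormedAddCommGroup H] [InnerProductSpace ℝ H]
    (J : H → EReal) (T : ℝ) (w₀ : H) (w : ℝ → H) : Prop :=
  ContinuousOn w (Icc 0 T) ∧
    (∀ a b : ℝ, 0 < a → a ≤ b → b < T → AbsolutelyContinuousOnInterval w a b) ∧
    (∀ᵐ t ∂(volume.restrict (Ioo 0 T)),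
      ∃ w' : H, HasDerivAt w w' t ∧ -w' ∈ frechetSubdifferential J (w t)) ∧
    w 0 = w₀

/-! ### The function spaces on a domain of `ℝᵈ` -/

/-- The real Hilbert space `L²(D)` for Lebesgue measure on `D`. -/
abbrev L2Space {d : ℕ} (D : Opens (EuclideanSpace ℝ (Fin d))) : Type :=
  Lp ℝ 2 (volume.restrict (D : Set (EuclideanSpace ℝ (Fin d))))

/-- `w ∈ H¹₀(D)`, the closure of `C_c^∞(D)` in the `H¹` norm: some test functions `φ n` converge to
`w` in `L²(D)` while their gradients converge in `L²(D; ℝᵈ)` (to `g`, the weak gradient of `w`). -/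
def MemH10 {d : ℕ} (D : Opens (EuclideanSpace ℝ (Fin d))) (w : L2Space D) : Prop :=
  ∃ (φ : ℕ → 𝓓(D, ℝ))
    (g : Lp (EuclideanSpace ℝ (Fin d)) 2 (volume.restrict (D : Set (EuclideanSpace ℝ (Fin d))))),
    Tendsto (fun n => eLpNorm (fun x => φ n x - w x) 2
      (volume.restrict (D : Set (EuclideanSpace ℝ (Fin d))))) atTop (𝓝 0) ∧
    Tendsto (fun n => eLpNorm (fun x => gradient (φ n) x - g x) 2
      (volume.restrict (D : Set (EuclideanSpace ℝ (Fin d))))) atTop (𝓝 0)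

/-- The set `X = {w ∈ H¹₀(D) : w ≥ 0, 1 + Δw ≥ 0}`, as a subset of `L²(D)`; the inequality
`1 + Δw ≥ 0` is meant in the sense of distributions on `D`. -/
def capacitaryRepresentatives {d : ℕ} (D : Opens (EuclideanSpace ℝ (Fin d))) :
    Set (L2Space D) :=
  {w | MemH10 D w ∧
    (∀ᵐ x ∂(volume.restrict (D : Set (EuclideanSpace ℝ (Fin d)))), 0 ≤ w x) ∧
    ∀ φ : 𝓓(D, ℝ), (∀ x, 0 ≤ φ x) →
      0 ≤ ∫ x in (D : Set (EuclideanSpace ℝ (Fin d))), (φ x + w x * (Δ (φ : _ → ℝ)) x)}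

/-! The statement is the generation theorem for gradient flows of `lam`-convex functionals on a
separable Hilbert space, applied to `L²(D)`. Put `κ = max (-lam) 0` and let `C` be the effective
domain.

For small `ε` the functional `J + ‖· - x‖² / (2ε)` is strongly convex, so each Euler step has a
minimizer, and its Euler-Lagrange inclusion says that `(x - y) / ε` is a subgradient at `y` up to
`κ/2 ‖· - y‖²`. Such subgradients are quasi-monotone (`IsSemisubgradient.neg_le_inner`), which makes
one step almost a contraction. Comparing orbits of steps `ε` and `δ` by a double induction of
Crandall-Liggett type (`IsEulerOrbit.pow_mul_pow_mul_sq_norm_sub_le`) shows that the scheme is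
Cauchy as `ε → 0` when it starts at a point of subdifferentiability. Density of such points and the
contraction extend this to the closure of `C` (`exists_isEulerLimit`).

The limit solves the flow because energy decay bounds the discrete velocities away from `t = 0`. The
limit is thus Lipschitz there, hence differentiable almost everywhere, and the discrete variational
inequality passes to the limit and identifies `-u'` as a subgradient
(`isSemisubgradient_of_hasDerivAt`).

The contraction of Euler limits carries the crude factor `exp (2κt)`. The sharp rate `exp (-lam t)`
and uniqueness of the flow come from differentiating `exp (2 lam t) ‖u - v‖²` along two solutions
(`IsGradientFlowSolution.norm_sub_le`). Minimizing movements are unique because two Euler schemes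
with the same start coincide for small `ε`. -/

/-! ### Almost everywhere differentiability of Lipschitz curves in a separable Hilbert space. -/

open scoped NNReal in
/-- A Lipschitz curve in a separable Hilbert space is differentiable almost everywhere. -/
theorem LipschitzWith.ae_differentiableAt_of_separable {H : Type*} [NormedAddCommGroup H]
    [InnerProductSpace ℝ H] [CompleteSpace H] [SeparableSpace H] {K : ℝ≥0} {u : ℝ → H}
    (hu : LipschitzWith K u) : ∀ᵐ t, DifferentiableAt ℝ u t := by
  obtain ⟨w, b, hb⟩ := exists_hilbertBasis ℝ H
  -- Orthonormal vectors are at distance `√2 > 1`, so the balls of radius `1/2` around them are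
  -- disjoint open sets in a separable space.
  have hwc : Countable w := by
    refine countable_coe_iff.2 (Set.countable_univ_iff.1 ?_)
    refine Set.PairwiseDisjoint.countable_of_isOpen (s := fun i : w => Metric.ball (b i) (1 / 2))
      (fun i _ j _ hij => Metric.ball_disjoint_ball ?_) (fun i _ => Metric.isOpen_ball)
      (fun i _ => ⟨b i, Metric.mem_ball_self (by norm_num)⟩)
    have h1 : ‖b i - b j‖ ^ 2 = 2 := by
      rw [norm_sub_sq_real, b.orthonormal.1 i, b.orthonormal.1 j, b.orthonormal.2 hij]
      norm_num
    rw [dist_eq_norm]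
    nlinarith [norm_nonneg (b i - b j)]
  have hf : ∀ i : w, LipschitzWith K (fun t => ⟪b i, u t⟫) := by
    intro i
    refine LipschitzWith.of_dist_le_mul fun s t => ?_
    rw [Real.dist_eq, ← inner_sub_right]
    refine (abs_real_inner_le_norm _ _).trans ?_
    rw [b.orthonormal.1 i, one_mul, ← dist_eq_norm]
    exact hu.dist_le_mul s t
  have hd : ∀ᵐ t, ∀ i, DifferentiableAt ℝ (fun t => ⟪b i, u t⟫) t :=
    ae_all_iff.2 fun i => (hf i).ae_differentiableAt_real
  -- Bessel's inequality for the difference quotients, of norm at most `K`, passes to the limit on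
  -- finite sets of coordinates, so the coordinate derivatives are those of a vector of norm at most
  -- `K`.
  have hsum : ∀ᵐ t, ∃ g : H, ‖g‖ ≤ K ∧ ∀ i, ⟪b i, g⟫ = deriv (fun t => ⟪b i, u t⟫) t := by
    filter_upwards [hd] with t ht
    have hle : ∀ s : Finset w, ∑ i ∈ s, ‖deriv (fun t => ⟪b i, u t⟫) t‖ ^ 2 ≤ (K : ℝ) ^ 2 := by
      intro s
      have h1 : Tendsto (fun x => ∑ i ∈ s, ‖slope (fun t => ⟪b i, u t⟫) t x‖ ^ 2) (𝓝[≠] t)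
          (𝓝 (∑ i ∈ s, ‖deriv (fun t => ⟪b i, u t⟫) t‖ ^ 2)) :=
        tendsto_finsetSum _ fun i _ =>
          ((hasDerivAt_iff_tendsto_slope.1 (ht i).hasDerivAt).norm.pow 2)
      refine le_of_tendsto h1 ?_
      filter_upwards [self_mem_nhdsWithin] with x hx
      have hx' : x - t ≠ 0 := sub_ne_zero.2 hx
      have h2 : ∀ i, slope (fun t => ⟪b i, u t⟫) t x = ⟪b i, slope u t x⟫ := by
        intro i
        simp [slope_def_module, inner_smul_right, inner_sub_right]
      simp_rw [h2]
      refine (b.orthonormal.sum_inner_products_le (slope u t x)).trans ?_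
      gcongr
      rw [slope_def_module, norm_smul, norm_inv, ← dist_eq_norm, ← dist_eq_norm,
        inv_mul_le_iff₀ (dist_pos.2 hx), mul_comm]
      exact hu.dist_le_mul x t
    have hmem : Memℓp (fun i : w => deriv (fun t => ⟪b i, u t⟫) t) 2 := by
      refine memℓp_gen' (C := (K : ℝ) ^ 2) fun s => ?_
      simpa using hle s
    refine ⟨b.repr.symm ⟨_, hmem⟩, ?_, fun i => ?_⟩
    · rw [LinearIsometryEquiv.norm_map]
      refine lp.norm_le_of_forall_sum_le (by simp) (by positivity) fun s => ?_
      simpa using hle s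
    · rw [← b.repr_apply_apply]
      simp
  classical
  let g : ℝ → H := fun t => if h : ∃ g : H, ‖g‖ ≤ K ∧
    ∀ i, ⟪b i, g⟫ = deriv (fun t => ⟪b i, u t⟫) t then h.choose else 0
  have hg : ∀ᵐ t, ‖g t‖ ≤ K ∧ ∀ i, ⟪b i, g t⟫ = deriv (fun t => ⟪b i, u t⟫) t := by
    filter_upwards [hsum] with t ht
    simp only [g, dif_pos ht]
    exact ht.choose_spec
  have hgm : AEStronglyMeasurable g := by
    refine aestronglyMeasurable_of_tendsto_ae (atTop : Filter (Finset w))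
      (f := fun s t => ∑ i ∈ s, deriv (fun t => ⟪b i, u t⟫) t • b i) (fun s => ?_) ?_
    · refine Finset.aestronglyMeasurable_fun_sum _ fun i _ => ?_
      exact (measurable_deriv _).aestronglyMeasurable.smul_const _
    · filter_upwards [hg] with t ht
      have := b.hasSum_repr (g t)
      simp_rw [b.repr_apply_apply, ht.2] at this
      exact this
  have hgl : LocallyIntegrable g := by
    intro x
    refine ⟨Metric.ball x 1, Metric.ball_mem_nhds _ one_pos, ?_⟩
    refine Measure.integrableOn_of_bounded (M := K) measure_ball_lt_top.ne hgm ?_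
    exact ae_restrict_of_ae (hg.mono fun t ht => ht.1)
  have hgi : ∀ x y : ℝ, IntervalIntegrable g volume x y := fun x y =>
    intervalIntegrable_iff.2 ((hgl.integrableOn_isCompact isCompact_uIcc).mono_set uIoc_subset_uIcc)
  -- Checked coordinatewise by the fundamental theorem of calculus for absolutely continuous real
  -- functions. Lebesgue differentiation of the integral of `g` then concludes.
  have hint : ∀ x, u x = u 0 + ∫ t in (0 : ℝ)..x, g t := by
    intro x
    refine b.repr.injective (lp.ext (funext fun i => ?_))
    have h1 : ⟪b i, ∫ t in (0 : ℝ)..x, g t⟫ = ∫ t in (0 : ℝ)..x, ⟪b i, g t⟫ :=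
      ((innerSL ℝ (b i)).intervalIntegral_comp_comm (hgi 0 x)).symm
    rw [b.repr_apply_apply, b.repr_apply_apply, inner_add_right, h1,
      intervalIntegral.integral_congr_ae
        (g := deriv (fun t => ⟪b i, u t⟫)) (hg.mono fun t ht _ => ht.2 i),
      ((hf i).lipschitzOnWith.absolutelyContinuousOnInterval).integral_deriv_eq_sub]
    ring
  filter_upwards [_root_.LocallyIntegrable.ae_hasDerivAt_integral hgl] with t ht
  have h1 : u = fun x => u 0 + ∫ t in (0 : ℝ)..x, g t := funext hint
  rw [h1]
  exact ((ht 0).const_add _).differentiableAt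

open scoped NNReal in
/-- A curve in a separable Hilbert space which is Lipschitz on a compact interval is
differentiable almost everywhere in the interior. -/
theorem LipschitzOnWith.ae_differentiableAt_of_separable {H : Type*} [NormedAddCommGroup H]
    [InnerProductSpace ℝ H] [CompleteSpace H] [SeparableSpace H] {K : ℝ≥0} {u : ℝ → H} {a b : ℝ}
    (hab : a ≤ b) (hu : LipschitzOnWith K u (Icc a b)) :
    ∀ᵐ t, t ∈ Ioo a b → DifferentiableAt ℝ u t := by
  have h1 : LipschitzWith (K * 1) (IccExtend hab ((Icc a b).domRestrict u)) :=
    (lipschitzOnWith_iff_restrict.1 hu).comp (LipschitzWith.projIcc hab)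
  filter_upwards [h1.ae_differentiableAt_of_separable] with t ht htab
  refine ht.congr_of_eventuallyEq ?_
  filter_upwards [Icc_mem_nhds htab.1 htab.2] with s hs
  rw [IccExtend_of_mem hab _ hs]
  rfl

/-! ### Semiconvex functionals and the proximal step. -/

section SemiconvexFunctionals

variable {H : Type*} [NormedAddCommGroup H] [InnerProductSpace ℝ H]

/-- `φ`, extended by `+∞` outside `C`, is proper, lower semicontinuous and `(-κ)`-convex. -/
structure IsClosedSemiconvex (C : Set H) (φ : H → ℝ) (κ : ℝ) : Prop where
  nonempty : C.Nonempty
  segment_mem : ∀ x ∈ C, ∀ y ∈ C, ∀ t ∈ Icc (0 : ℝ) 1, (1 - t) • x + t • y ∈ C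
  segment_le : ∀ x ∈ C, ∀ y ∈ C, ∀ t ∈ Icc (0 : ℝ) 1,
    φ ((1 - t) • x + t • y) ≤ (1 - t) * φ x + t * φ y + κ / 2 * t * (1 - t) * ‖x - y‖ ^ 2
  isClosed_sublevel : ∀ c, IsClosed {x | x ∈ C ∧ φ x ≤ c}

/-- `p` is a subgradient of `φ` at `y ∈ C`, up to a quadratic error with constant `κ`. -/
def IsSemisubgradient (C : Set H) (φ : H → ℝ) (κ : ℝ) (y p : H) : Prop :=
  y ∈ C ∧ ∀ v ∈ C, φ y + ⟪p, v - y⟫ ≤ φ v + κ / 2 * ‖v - y‖ ^ 2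

/-- `X` solves the implicit Euler scheme of step `ε` for the inclusion `x' ∈ -∂φ(x)`. -/
def IsEulerOrbit (C : Set H) (φ : H → ℝ) (κ ε : ℝ) (X : ℕ → H) : Prop :=
  ∀ n, IsSemisubgradient C φ κ (X (n + 1)) (ε⁻¹ • (X n - X (n + 1)))

variable {C : Set H} {φ : H → ℝ} {κ : ℝ}

/-- Adding the two subgradient inequalities cancels the values of `φ`. This quasi-monotonicity is
the source of all the contraction estimates. -/
theorem IsSemisubgradient.neg_le_inner {y z p q : H} (hp : IsSemisubgradient C φ κ y p)
    (hq : IsSemisubgradient C φ κ z q) : -(κ * ‖y - z‖ ^ 2) ≤ ⟪p - q, y - z⟫ := by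
  have h1 := hp.2 z hq.1
  have h2 := hq.2 y hp.1
  rw [← neg_sub y z, inner_neg_right, norm_neg] at h1
  rw [inner_sub_left]
  linarith

namespace IsClosedSemiconvex

theorem mem_and_le_of_tendsto (h : IsClosedSemiconvex C φ κ) {ι : Type*} {l : Filter ι} [l.NeBot]
    {c : ι → ℝ} {x : ι → H} {y : H} {d : ℝ} (hx : ∀ᶠ n in l, x n ∈ C ∧ φ (x n) ≤ c n)
    (hxy : Tendsto x l (𝓝 y)) (hc : Tendsto c l (𝓝 d)) : y ∈ C ∧ φ y ≤ d := by
  have key : ∀ e > d, y ∈ C ∧ φ y ≤ e := by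
    intro e he
    refine (h.isClosed_sublevel e).mem_of_tendsto hxy ?_
    filter_upwards [hx, hc.eventually (gt_mem_nhds he)] with n hn hn'
    exact ⟨hn.1, hn.2.trans hn'.le⟩
  exact ⟨(key (d + 1) (by linarith)).1, le_of_forall_gt_imp_ge_of_dense fun e he => (key e he).2⟩

/-- A closed semiconvex functional is bounded below by a negative quadratic. -/
theorem exists_quadratic_lower_bound (h : IsClosedSemiconvex C φ κ) (hκ : 0 ≤ κ) :
    ∃ M, 0 ≤ M ∧ ∀ v ∈ C, -(M * (1 + ‖v‖ ^ 2)) ≤ φ v := by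
  obtain ⟨x, hx⟩ := h.nonempty
  -- By lower semicontinuity `φ > φ x - 1` on `C` within distance `r` of `x`. A point `v` farther
  -- away is handled by convexity on the segment from `x` to `v`.
  obtain ⟨r, hr, hball⟩ := Metric.isOpen_iff.1 (h.isClosed_sublevel (φ x - 1)).isOpen_compl x
    (by simp)
  refine ⟨(|φ x| + 1 + 2 / r * (1 + ‖x‖) + κ * (1 + ‖x‖ ^ 2)), by positivity, fun v hv => ?_⟩
  have hvx : ‖v - x‖ ≤ ‖v‖ + ‖x‖ := norm_sub_le v x
  have hvx2 : ‖v - x‖ ^ 2 ≤ 2 * ‖v‖ ^ 2 + 2 * ‖x‖ ^ 2 := by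
    nlinarith [norm_nonneg (v - x), sq_nonneg (‖v‖ - ‖x‖)]
  have main : φ x - 1 - 2 / r * ‖v - x‖ - κ / 2 * ‖v - x‖ ^ 2 ≤ φ v := by
    by_cases hR : ‖v - x‖ < r
    · have h1 : φ x - 1 < φ v := by
        by_contra! hcon
        exact hball (a := v) (by rwa [mem_ball_iff_norm]) ⟨hv, hcon⟩
      have : 0 ≤ 2 / r * ‖v - x‖ + κ / 2 * ‖v - x‖ ^ 2 := by positivity
      linarith
    · push Not at hR
      have hR0 : 0 < ‖v - x‖ := hr.trans_le hR
      -- This `t` places the point of the segment at distance `r / 2` from `x`, inside the ball.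
      set t := r / (2 * ‖v - x‖) with ht
      have ht0 : 0 < t := by positivity
      have ht1 : t ≤ 1 := by
        rw [ht, div_le_one (by positivity)]
        linarith
      have htI : t ∈ Icc (0 : ℝ) 1 := ⟨ht0.le, ht1⟩
      have h2 := h.segment_le x hx v hv t htI
      have h1 : φ x - 1 < φ ((1 - t) • x + t • v) := by
        by_contra! hcon
        refine hball (a := (1 - t) • x + t • v) ?_ ⟨h.segment_mem x hx v hv t htI, hcon⟩
        rw [mem_ball_iff_norm, show (1 - t) • x + t • v - x = t • (v - x) by module, norm_smul,
          Real.norm_of_nonneg ht0.le, ht]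
        field_simp
        linarith
      have h3 : t * (2 / r * ‖v - x‖) = 1 := by
        rw [ht]
        field_simp
      rw [norm_sub_rev x v] at h2
      have h4 : κ / 2 * t * (1 - t) * ‖v - x‖ ^ 2 ≤ t * (κ / 2 * ‖v - x‖ ^ 2) := by
        have : 0 ≤ κ / 2 * t * ‖v - x‖ ^ 2 * t := by positivity
        linarith
      have h5 : t * (φ x - 1 - 2 / r * ‖v - x‖ - κ / 2 * ‖v - x‖ ^ 2) ≤ t * φ v := by
        linarith
      exact le_of_mul_le_mul_left h5 ht0
  have h6 : 2 / r * ‖v - x‖ ≤ 2 / r * (1 + ‖x‖) * (1 + ‖v‖ ^ 2) := by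
    rw [mul_assoc]
    gcongr
    nlinarith [norm_nonneg v, norm_nonneg x, sq_nonneg (‖v‖ - 1), sq_nonneg ‖v‖,
      mul_nonneg (norm_nonneg x) (sq_nonneg ‖v‖)]
  have h7 : κ / 2 * ‖v - x‖ ^ 2 ≤ κ * (1 + ‖x‖ ^ 2) * (1 + ‖v‖ ^ 2) := by
    have : ‖v‖ ^ 2 + ‖x‖ ^ 2 ≤ (1 + ‖x‖ ^ 2) * (1 + ‖v‖ ^ 2) := by
      nlinarith [mul_nonneg (sq_nonneg ‖x‖) (sq_nonneg ‖v‖)]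
    nlinarith
  have h8 : |φ x| + 1 ≤ (|φ x| + 1) * (1 + ‖v‖ ^ 2) :=
    le_mul_of_one_le_right (by positivity) (by nlinarith [sq_nonneg ‖v‖])
  linarith [neg_abs_le (φ x)]

/-- Minimizers of the proximal functional solve the implicit Euler inclusion. -/
theorem isSemisubgradient_of_forall_le (h : IsClosedSemiconvex C φ κ) {ε : ℝ}
    {x y : H} (hy : y ∈ C)
    (hmin : ∀ v ∈ C, φ y + ‖y - x‖ ^ 2 / (2 * ε) ≤ φ v + ‖v - x‖ ^ 2 / (2 * ε)) :
    IsSemisubgradient C φ κ y (ε⁻¹ • (x - y)) := by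
  refine ⟨hy, fun v hv => ?_⟩
  -- Minimality is tested at `(1 - t) y + t v` and the result divided by `t`; letting `t → 0`
  -- removes the last term.
  have key : ∀ t ∈ Ioc (0 : ℝ) 1, φ y + ⟪ε⁻¹ • (x - y), v - y⟫ ≤
      φ v + κ / 2 * (1 - t) * ‖v - y‖ ^ 2 + t * (‖v - y‖ ^ 2 / (2 * ε)) := by
    intro t ht
    have htI : t ∈ Icc (0 : ℝ) 1 := ⟨ht.1.le, ht.2⟩
    have h1 := hmin _ (h.segment_mem y hy v hv t htI)
    have h2 := h.segment_le y hy v hv t htI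
    have h3 : ‖(1 - t) • y + t • v - x‖ ^ 2 =
        ‖y - x‖ ^ 2 - 2 * t * ⟪x - y, v - y⟫ + t ^ 2 * ‖v - y‖ ^ 2 := by
      rw [show (1 - t) • y + t • v - x = t • (v - y) - (x - y) by module, norm_sub_sq_real,
        norm_smul, inner_smul_left, real_inner_comm, norm_sub_rev x y, mul_pow, Real.norm_eq_abs,
        sq_abs]
      simp
      ring
    rw [norm_sub_rev y v] at h2
    rw [h3] at h1
    rw [inner_smul_left]
    simp only [conj_trivial]
    have h4 : t * (φ y + ε⁻¹ * ⟪x - y, v - y⟫) ≤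
        t * (φ v + κ / 2 * (1 - t) * ‖v - y‖ ^ 2 + t * (‖v - y‖ ^ 2 / (2 * ε))) := by
      have h5 : (‖y - x‖ ^ 2 - 2 * t * ⟪x - y, v - y⟫ + t ^ 2 * ‖v - y‖ ^ 2) / (2 * ε) =
          ‖y - x‖ ^ 2 / (2 * ε) - t * (ε⁻¹ * ⟪x - y, v - y⟫) +
            t * (t * (‖v - y‖ ^ 2 / (2 * ε))) := by
        rcases eq_or_ne ε 0 with rfl | hε
        · simp
        · field_simp
      rw [h5] at h1
      linarith
    exact le_of_mul_le_mul_left h4 ht.1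
  have hlim : Tendsto (fun t : ℝ => φ v + κ / 2 * (1 - t) * ‖v - y‖ ^ 2 +
      t * (‖v - y‖ ^ 2 / (2 * ε))) (𝓝[>] 0) (𝓝 (φ v + κ / 2 * ‖v - y‖ ^ 2)) := by
    refine tendsto_nhdsWithin_of_tendsto_nhds ?_
    have : Continuous (fun t : ℝ => φ v + κ / 2 * (1 - t) * ‖v - y‖ ^ 2 +
      t * (‖v - y‖ ^ 2 / (2 * ε))) := by fun_prop
    simpa using this.tendsto 0
  exact ge_of_tendsto hlim (eventually_of_mem (Ioc_mem_nhdsGT one_pos) key)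

variable [CompleteSpace H]

/-- The condition `4Mε ≤ 1` lets the quadratic penalty dominate the lower bound on `φ`, so the
infimum is finite. The condition `2κε ≤ 1` leaves strong convexity, so minimizing sequences are
Cauchy; lower semicontinuity makes the limit a minimizer. -/
theorem exists_forall_proximal_le (h : IsClosedSemiconvex C φ κ) {M ε : ℝ}
    (hM : ∀ v ∈ C, -(M * (1 + ‖v‖ ^ 2)) ≤ φ v) (hε : 0 < ε) (hεM : 4 * M * ε ≤ 1)
    (hεκ : 2 * κ * ε ≤ 1) (x : H) :
    ∃ y ∈ C, ∀ v ∈ C, φ y + ‖y - x‖ ^ 2 / (2 * ε) ≤ φ v + ‖v - x‖ ^ 2 / (2 * ε) := by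
  set Ψ : H → ℝ := fun v => φ v + ‖v - x‖ ^ 2 / (2 * ε) with hΨ
  have hbdd : BddBelow (Ψ '' C) := by
    refine ⟨-M - ‖x‖ ^ 2 / (2 * ε), ?_⟩
    rintro _ ⟨v, hv, rfl⟩
    have h1 := hM v hv
    have h2 : ‖v‖ ^ 2 ≤ 2 * ‖v - x‖ ^ 2 + 2 * ‖x‖ ^ 2 := by
      have := norm_add_le (v - x) x
      rw [sub_add_cancel] at this
      nlinarith [norm_nonneg v, sq_nonneg (‖v - x‖ - ‖x‖)]
    have h3 : M * ‖v‖ ^ 2 ≤ (‖v - x‖ ^ 2 + ‖x‖ ^ 2) / (2 * ε) := by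
      rw [le_div_iff₀ (by positivity)]
      nlinarith [sq_nonneg ‖v‖]
    rw [add_div] at h3
    simp only [hΨ]
    linarith
  have hne : (Ψ '' C).Nonempty := h.nonempty.image _
  set m := sInf (Ψ '' C)
  have hm : ∀ v ∈ C, m ≤ Ψ v := fun v hv => csInf_le hbdd ⟨v, hv, rfl⟩
  have hseq : ∀ n : ℕ, ∃ v ∈ C, Ψ v < m + 1 / ((n : ℝ) + 1) := by
    intro n
    obtain ⟨_, ⟨v, hv, rfl⟩, hlt⟩ := exists_lt_of_csInf_lt hne
      (show m < m + 1 / ((n : ℝ) + 1) by have := Nat.one_div_pos_of_nat (α := ℝ) (n := n); linarith)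
    exact ⟨v, hv, hlt⟩
  choose v hvC hv using hseq
  -- The parallelogram law at the midpoint gains `‖a - b‖² / (8ε)`, and the lack of convexity costs
  -- `κ/8 ‖a - b‖²`, at most half of that gain.
  have hmid : ∀ a ∈ C, ∀ b ∈ C, ‖a - b‖ ^ 2 ≤ 8 * ε * (Ψ a + Ψ b - 2 * m) := by
    intro a ha b hb
    have hI : (1 / 2 : ℝ) ∈ Icc (0 : ℝ) 1 := by norm_num
    have h1 := hm _ (h.segment_mem a ha b hb _ hI)
    have h2 := h.segment_le a ha b hb _ hI
    have h3 : ‖(1 - 1 / 2 : ℝ) • a + (1 / 2 : ℝ) • b - x‖ ^ 2 =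
        ‖a - x‖ ^ 2 / 2 + ‖b - x‖ ^ 2 / 2 - ‖a - b‖ ^ 2 / 4 := by
      have h4 := parallelogram_law_with_norm ℝ (a - x) (b - x)
      rw [show (1 - 1 / 2 : ℝ) • a + (1 / 2 : ℝ) • b - x = (1 / 2 : ℝ) • (a - x + (b - x)) by
        module, norm_smul, mul_pow]
      rw [sub_sub_sub_cancel_right] at h4
      norm_num
      linarith
    simp only [hΨ] at h1 ⊢
    rw [h3] at h1
    have h5 : 2 * ε * ((‖a - x‖ ^ 2 / 2 + ‖b - x‖ ^ 2 / 2 - ‖a - b‖ ^ 2 / 4) / (2 * ε)) =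
        ‖a - x‖ ^ 2 / 2 + ‖b - x‖ ^ 2 / 2 - ‖a - b‖ ^ 2 / 4 := by field_simp
    have h6 : ∀ s : ℝ, 2 * ε * (s / (2 * ε)) = s := fun s => by field_simp
    have h7 := h6 (‖a - x‖ ^ 2)
    have h8 := h6 (‖b - x‖ ^ 2)
    have h9 : 2 * ε * m ≤ 2 * ε * ((1 - 1 / 2) * φ a + 1 / 2 * φ b +
      κ / 2 * (1 / 2) * (1 - 1 / 2) * ‖a - b‖ ^ 2 +
      ((‖a - x‖ ^ 2 / 2 + ‖b - x‖ ^ 2 / 2 - ‖a - b‖ ^ 2 / 4) / (2 * ε))) := by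
      gcongr
      linarith
    have h10 : κ * ε * ‖a - b‖ ^ 2 ≤ 1 / 2 * ‖a - b‖ ^ 2 := by
      gcongr
      linarith
    linarith
  have hcs : CauchySeq v := by
    have hlim : Tendsto (fun n : ℕ => √(8 * ε * (2 * (1 / ((n : ℝ) + 1))))) atTop (𝓝 0) := by
      have := ((tendsto_one_div_add_atTop_nhds_zero_nat (𝕜 := ℝ)).const_mul 2).const_mul (8 * ε)
      simpa [Function.comp_def] using (Real.continuous_sqrt.tendsto _).comp this
    refine cauchySeq_of_le_tendsto_0 _ (fun n k N hn hk => ?_) hlim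
    rw [dist_eq_norm]
    refine Real.le_sqrt_of_sq_le ((hmid _ (hvC n) _ (hvC k)).trans ?_)
    have h1 : 1 / ((n : ℝ) + 1) ≤ 1 / ((N : ℝ) + 1) := Nat.one_div_le_one_div hn
    have h2 : 1 / ((k : ℝ) + 1) ≤ 1 / ((N : ℝ) + 1) := Nat.one_div_le_one_div hk
    gcongr
    linarith [hv n, hv k]
  obtain ⟨y, hy⟩ := cauchySeq_tendsto_of_complete hcs
  have hlim : Tendsto (fun n : ℕ => m + 1 / ((n : ℝ) + 1) - ‖v n - x‖ ^ 2 / (2 * ε)) atTop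
      (𝓝 (m + 0 - ‖y - x‖ ^ 2 / (2 * ε))) :=
    ((tendsto_one_div_add_atTop_nhds_zero_nat (𝕜 := ℝ)).const_add m).sub
      (((hy.sub_const x).norm.pow 2).div_const _)
  obtain ⟨hyC, hyle⟩ := h.mem_and_le_of_tendsto
    (Eventually.of_forall fun n => ⟨hvC n, by have := hv n; simp only [hΨ] at this; linarith⟩)
    hy hlim
  exact ⟨y, hyC, fun z hz => by have := hm z hz; simp only [hΨ] at this; linarith⟩

/-- For small steps the implicit Euler scheme is solvable from every starting point. -/
theorem exists_proximal_step (h : IsClosedSemiconvex C φ κ) (hκ : 0 ≤ κ) :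
    ∃ ε₀ > 0, ∀ ε ∈ Ioc 0 ε₀, ∀ x, ∃ y ∈ C, ∀ v ∈ C,
      φ y + ‖y - x‖ ^ 2 / (2 * ε) ≤ φ v + ‖v - x‖ ^ 2 / (2 * ε) := by
  obtain ⟨M, hM0, hM⟩ := h.exists_quadratic_lower_bound hκ
  have key : ∀ a, 0 ≤ a → a ≤ M + κ → 4 * a * (1 / (4 * (M + κ + 1))) ≤ 1 := by
    intro a _ ha
    rw [mul_one_div, div_le_one (by positivity)]
    linarith
  refine ⟨1 / (4 * (M + κ + 1)), by positivity, fun ε hε x => ?_⟩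
  refine h.exists_forall_proximal_le hM hε.1 (le_trans ?_ (key M hM0 (by linarith)))
    (le_trans ?_ (key κ hκ (by linarith))) x
  · exact mul_le_mul_of_nonneg_left hε.2 (by positivity)
  · nlinarith [hε.1, hε.2, mul_nonneg hκ hε.1.le, mul_le_mul_of_nonneg_left hε.2 hκ]

theorem exists_eulerOrbit_family (h : IsClosedSemiconvex C φ κ) (hκ : 0 ≤ κ) (x : H) :
    ∃ W : ℝ → ℕ → H, ∀ᶠ ε in 𝓝[>] (0 : ℝ), W ε 0 = x ∧ IsEulerOrbit C φ κ ε (W ε) ∧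
      ∀ n, W ε (n + 1) ∈ C ∧ ∀ v ∈ C, φ (W ε (n + 1)) + ‖W ε (n + 1) - W ε n‖ ^ 2 / (2 * ε) ≤
        φ v + ‖v - W ε n‖ ^ 2 / (2 * ε) := by
  obtain ⟨ε₀, hε₀, hprox⟩ := h.exists_proximal_step hκ
  choose! R hR using hprox
  refine ⟨fun ε n => (R ε)^[n] x, eventually_of_mem (Ioc_mem_nhdsGT hε₀) fun ε hε => ?_⟩
  have key : ∀ n, (R ε)^[n + 1] x ∈ C ∧ ∀ v ∈ C,
      φ ((R ε)^[n + 1] x) + ‖(R ε)^[n + 1] x - (R ε)^[n] x‖ ^ 2 / (2 * ε) ≤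
        φ v + ‖v - (R ε)^[n] x‖ ^ 2 / (2 * ε) := by
    intro n
    rw [Function.iterate_succ_apply']
    exact hR ε hε _
  exact ⟨rfl, fun n => h.isSemisubgradient_of_forall_le (key n).1 (key n).2, key⟩

/-- Points at which the subdifferential is nonempty are dense in the closure of the domain. -/
theorem exists_isSemisubgradient_near (h : IsClosedSemiconvex C φ κ) (hκ : 0 ≤ κ) {x : H}
    (hx : x ∈ closure C) {η : ℝ} (hη : 0 < η) :
    ∃ y p, IsSemisubgradient C φ κ y p ∧ ‖x - y‖ < η := by
  obtain ⟨z, hz, hxz⟩ := Metric.mem_closure_iff.1 hx (η / 2) (by positivity)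
  obtain ⟨M, hM0, hM⟩ := h.exists_quadratic_lower_bound hκ
  obtain ⟨ε₀, hε₀, hprox⟩ := h.exists_proximal_step hκ
  -- The point sought is a proximal point `y` of `z`. Comparing with `z` gives `‖y - z‖² / (2ε) ≤ A
  -- + 2M ‖y - z‖²`; `8Mε < 1` absorbs the last term, and `4εA` bounds the rest.
  set A := φ z + M * (1 + 2 * ‖z‖ ^ 2) with hA
  have hA0 : 0 ≤ A := by
    have := hM z hz
    nlinarith [mul_nonneg hM0 (sq_nonneg ‖z‖)]
  have hev : ∀ᶠ ε in 𝓝[>] (0 : ℝ), ε ∈ Ioc 0 ε₀ ∧ 8 * M * ε < 1 ∧ 4 * ε * A < (η / 2) ^ 2 := by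
    refine (eventually_of_mem (Ioc_mem_nhdsGT hε₀) fun _ h => h).and (Eventually.and ?_ ?_)
    · refine tendsto_nhdsWithin_of_tendsto_nhds (f := fun ε : ℝ => 8 * M * ε)
        ((Continuous.tendsto (by fun_prop) 0)) |>.eventually (gt_mem_nhds (by norm_num))
    · refine tendsto_nhdsWithin_of_tendsto_nhds (f := fun ε : ℝ => 4 * ε * A)
        ((Continuous.tendsto (by fun_prop) 0)) |>.eventually (gt_mem_nhds ?_)
      simp only [mul_zero, zero_mul]
      positivity
  obtain ⟨ε, hε, hεM, hεA⟩ := hev.exists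
  obtain ⟨y, hy, hmin⟩ := hprox ε hε z
  refine ⟨y, _, h.isSemisubgradient_of_forall_le hy hmin, ?_⟩
  have hyz : ‖y - z‖ < η / 2 := by
    have h1 := hmin z hz
    have h2 := hM y hy
    have h3 : ‖y‖ ^ 2 ≤ 2 * ‖y - z‖ ^ 2 + 2 * ‖z‖ ^ 2 := by
      have := norm_add_le (y - z) z
      rw [sub_add_cancel] at this
      nlinarith [norm_nonneg y, sq_nonneg (‖y - z‖ - ‖z‖)]
    have h4 : ‖y - z‖ ^ 2 / (2 * ε) ≤ A + 2 * M * ‖y - z‖ ^ 2 := by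
      simp only [sub_self, norm_zero, ne_eq, OfNat.ofNat_ne_zero, not_false_eq_true, zero_pow,
        zero_div, add_zero] at h1
      nlinarith
    rw [div_le_iff₀ (by have := hε.1; positivity)] at h4
    refine lt_of_pow_lt_pow_left₀ 2 (by positivity) ?_
    nlinarith [sq_nonneg ‖y - z‖]
  calc ‖x - y‖ ≤ ‖x - z‖ + ‖z - y‖ := norm_sub_le_norm_sub_add_norm_sub _ _ _
    _ < η := by rw [norm_sub_rev z y, ← dist_eq_norm]; linarith

end IsClosedSemiconvex

end SemiconvexFunctionals

/-! ### Contraction estimates for implicit Euler orbits. -/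

section EulerOrbits

/-- With `s = κε ≤ 1/4` one has `(1 + 4s)(1 - 2s) ≥ 1`, hence `exp (-4s) ≤ 1 - 2s`. This makes the
discrete contraction factors uniform in the step on bounded times. -/
theorem Real.exp_neg_le_one_sub_pow {κ ε τ : ℝ} (hκ : 0 ≤ κ) (hε : 0 ≤ ε) (hεκ : 4 * κ * ε ≤ 1)
    {n : ℕ} (hn : n * ε ≤ τ) : Real.exp (-(4 * κ * τ)) ≤ (1 - 2 * κ * ε) ^ n := by
  have hs : 0 ≤ κ * ε := mul_nonneg hκ hε
  have h1 : Real.exp (-(4 * κ * ε)) ≤ 1 - 2 * κ * ε := by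
    rw [Real.exp_neg, inv_le_comm₀ (Real.exp_pos _) (by linarith)]
    refine le_trans ?_ (Real.add_one_le_exp _)
    rw [inv_le_iff_one_le_mul₀ (by linarith)]
    nlinarith
  calc Real.exp (-(4 * κ * τ)) ≤ Real.exp (n * -(4 * κ * ε)) := by
        gcongr
        nlinarith
    _ = Real.exp (-(4 * κ * ε)) ^ n := Real.exp_nat_mul _ _
    _ ≤ _ := by gcongr

theorem norm_sub_le_mul_of_forall_succ {E : Type*} [SeminormedAddCommGroup E] {X : ℕ → E}
    {s : ℝ} {n m : ℕ} (hnm : n ≤ m)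
    (h : ∀ k, n ≤ k → k < m → ‖X (k + 1) - X k‖ ≤ s) : ‖X m - X n‖ ≤ ((m : ℝ) - n) * s := by
  rw [norm_sub_rev, ← dist_eq_norm]
  refine (dist_le_Ico_sum_of_dist_le hnm (d := fun _ => s) fun {k} hk hk' => ?_).trans ?_
  · rw [dist_comm, dist_eq_norm]
    exact h k hk hk'
  · simp [hnm]

variable {H : Type*} [NormedAddCommGroup H] [InnerProductSpace ℝ H]
variable {C : Set H} {φ : H → ℝ} {κ : ℝ}

namespace IsSemisubgradient

theorem step_sq_le {ε : ℝ} (hε : 0 < ε) {x y x' y' : H}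
    (h : IsSemisubgradient C φ κ y (ε⁻¹ • (x - y)))
    (h' : IsSemisubgradient C φ κ y' (ε⁻¹ • (x' - y'))) :
    (1 - 2 * κ * ε) * ‖y - y'‖ ^ 2 ≤ ‖x - x'‖ ^ 2 := by
  have h1 := h.neg_le_inner h'
  rw [show ε⁻¹ • (x - y) - ε⁻¹ • (x' - y') = ε⁻¹ • ((x - x') - (y - y')) by module,
    inner_smul_left, inner_sub_left, real_inner_self_eq_norm_sq] at h1
  simp only [conj_trivial] at h1
  have h2 : ε * -(κ * ‖y - y'‖ ^ 2) ≤ ⟪x - x', y - y'⟫ - ‖y - y'‖ ^ 2 := by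
    calc _ ≤ ε * (ε⁻¹ * (⟪x - x', y - y'⟫ - ‖y - y'‖ ^ 2)) := by gcongr
      _ = _ := by field_simp
  have h3 := norm_sub_sq_real (x - x') (y - y')
  nlinarith [sq_nonneg ‖x - x' - (y - y')‖]

/-- Quasi-monotonicity at `y, y'` with unequal steps, each cross term estimated by a square. Applied
to two orbits, it bounds the pair `(m+1, n+1)` by the pairs `(m, n+1)` and `(m+1, n)`. -/
theorem two_step_sq_le {ε δ : ℝ} (hε : 0 < ε) (hδ : 0 < δ) {x y x' y' : H}
    (h : IsSemisubgradient C φ κ y (ε⁻¹ • (x - y)))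
    (h' : IsSemisubgradient C φ κ y' (δ⁻¹ • (x' - y'))) :
    (ε + δ - 2 * κ * ε * δ) * ‖y - y'‖ ^ 2 ≤ δ * ‖x - y'‖ ^ 2 + ε * ‖y - x'‖ ^ 2 := by
  have h1 := h.neg_le_inner h'
  rw [show ε⁻¹ • (x - y) - δ⁻¹ • (x' - y') =
    ε⁻¹ • ((x - y') - (y - y')) - δ⁻¹ • ((y - y') - (y - x')) by module,
    inner_sub_left, inner_smul_left, inner_smul_left, inner_sub_left (x - y'),
    inner_sub_left (y - y'), real_inner_self_eq_norm_sq] at h1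
  simp only [conj_trivial] at h1
  have h2 : (ε * δ) * -(κ * ‖y - y'‖ ^ 2) ≤ δ * (⟪x - y', y - y'⟫ - ‖y - y'‖ ^ 2) -
      ε * (‖y - y'‖ ^ 2 - ⟪y - x', y - y'⟫) := by
    calc _ ≤ (ε * δ) * (ε⁻¹ * (⟪x - y', y - y'⟫ - ‖y - y'‖ ^ 2) -
        δ⁻¹ * (‖y - y'‖ ^ 2 - ⟪y - x', y - y'⟫)) := by gcongr
      _ = _ := by field_simp
  have h3 := norm_sub_sq_real (x - y') (y - y')
  have h4 := norm_sub_sq_real (y - x') (y - y')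
  have h5 := mul_nonneg hδ.le (sq_nonneg ‖x - y' - (y - y')‖)
  have h6 := mul_nonneg hε.le (sq_nonneg ‖y - x' - (y - y')‖)
  rw [h3] at h5
  rw [h4] at h6
  linarith

/-- Discrete evolution variational inequality: the subgradient inequality at `y` tested with `v`,
its inner product expanded into squares. -/
theorem sq_norm_sub_le {ε : ℝ} (hε : 0 < ε) {x y v : H}
    (h : IsSemisubgradient C φ κ y (ε⁻¹ • (x - y))) (hv : v ∈ C) :
    ‖y - v‖ ^ 2 - ‖x - v‖ ^ 2 + ‖x - y‖ ^ 2 ≤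
      2 * ε * (φ v - φ y) + κ * ε * ‖y - v‖ ^ 2 := by
  have h1 := h.2 v hv
  rw [inner_smul_left] at h1
  simp only [conj_trivial] at h1
  have h2 : ⟪x - y, v - y⟫ ≤ ε * (φ v - φ y + κ / 2 * ‖v - y‖ ^ 2) := by
    calc _ = ε * (ε⁻¹ * ⟪x - y, v - y⟫) := by field_simp
      _ ≤ _ := by gcongr; linarith
  have h3 := norm_sub_sq_real (x - y) (v - y)
  rw [sub_sub_sub_cancel_right, norm_sub_rev v y] at h3
  rw [norm_sub_rev v y] at h2
  linarith

end IsSemisubgradient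

namespace IsEulerOrbit

variable {ε δ : ℝ} {X Y : ℕ → H}

theorem shift (h : IsEulerOrbit C φ κ ε X) (k : ℕ) :
    IsEulerOrbit C φ κ ε (fun n => X (n + k)) := fun n => by
  have := h (n + k)
  rwa [add_right_comm] at this

theorem pow_mul_sq_norm_sub_le (hε : 0 < ε) (hθ : 2 * κ * ε ≤ 1) (hX : IsEulerOrbit C φ κ ε X)
    (hY : IsEulerOrbit C φ κ ε Y) (n : ℕ) :
    (1 - 2 * κ * ε) ^ n * ‖X n - Y n‖ ^ 2 ≤ ‖X 0 - Y 0‖ ^ 2 := by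
  induction n with
  | zero => simp
  | succ n ih =>
    refine le_trans ?_ ih
    rw [pow_succ, mul_assoc]
    exact mul_le_mul_of_nonneg_left ((hX n).step_sq_le hε (hY n)) (pow_nonneg (by linarith) _)

theorem norm_sub_le (hκ : 0 ≤ κ) (hε : 0 < ε) (hεκ : 4 * κ * ε ≤ 1)
    (hX : IsEulerOrbit C φ κ ε X) (hY : IsEulerOrbit C φ κ ε Y) {n : ℕ} {τ : ℝ}
    (hn : n * ε ≤ τ) : ‖X n - Y n‖ ≤ Real.exp (2 * κ * τ) * ‖X 0 - Y 0‖ := by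
  have h1 := pow_mul_sq_norm_sub_le hε (by nlinarith [mul_nonneg hκ hε.le]) hX hY n
  have h2 := Real.exp_neg_le_one_sub_pow hκ hε.le hεκ hn
  have h3 : Real.exp (-(4 * κ * τ)) * ‖X n - Y n‖ ^ 2 ≤ ‖X 0 - Y 0‖ ^ 2 :=
    (mul_le_mul_of_nonneg_right h2 (sq_nonneg _)).trans h1
  refine le_of_sq_le_sq ?_ (by positivity)
  rw [mul_pow, ← Real.exp_nat_mul]
  calc ‖X n - Y n‖ ^ 2 = Real.exp ((2 : ℕ) * (2 * κ * τ)) *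
        (Real.exp (-(4 * κ * τ)) * ‖X n - Y n‖ ^ 2) := by
        rw [← mul_assoc, ← Real.exp_add]
        rw [show ((2 : ℕ) : ℝ) * (2 * κ * τ) + -(4 * κ * τ) = 0 by push_cast; ring]
        simp
    _ ≤ _ := by gcongr

/-- The contraction applied to an orbit and its own shift by one: step lengths are almost
nonincreasing. -/
theorem pow_mul_sq_norm_succ_sub_le (hε : 0 < ε) (hθ : 2 * κ * ε ≤ 1)
    (hX : IsEulerOrbit C φ κ ε X) (N k : ℕ) :
    (1 - 2 * κ * ε) ^ k * ‖X (N + k + 1) - X (N + k)‖ ^ 2 ≤ ‖X (N + 1) - X N‖ ^ 2 := by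
  have h1 := pow_mul_sq_norm_sub_le hε hθ (hX.shift (N + 1)) (hX.shift N) k
  rwa [zero_add, zero_add, add_comm k N, ← add_assoc, add_comm k N] at h1

theorem pow_mul_sq_norm_succ_sub_le_of_subgradient (hε : 0 < ε) (hθ : 2 * κ * ε ≤ 1)
    (hX : IsEulerOrbit C φ κ ε X) {p : H} (hp : IsSemisubgradient C φ κ (X 0) p) (n : ℕ) :
    (1 - 2 * κ * ε) ^ (n + 1) * ‖X (n + 1) - X n‖ ^ 2 ≤ (ε * ‖p‖) ^ 2 := by
  have h1 := pow_mul_sq_norm_succ_sub_le hε hθ hX 0 n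
  have h2 : (1 - 2 * κ * ε) * ‖X 1 - X 0‖ ^ 2 ≤ (ε * ‖p‖) ^ 2 := by
    -- A subgradient `p` at `X 0` makes `X 0` the result of an Euler step from `X 0 + ε p`, so the
    -- one-step contraction bounds the first increment by `ε ‖p‖`.
    have h3 : IsSemisubgradient C φ κ (X 0) (ε⁻¹ • ((X 0 + ε • p) - X 0)) := by
      rwa [add_sub_cancel_left, inv_smul_smul₀ hε.ne']
    have h4 := (hX 0).step_sq_le hε h3
    rwa [sub_add_cancel_left, norm_neg, norm_smul, Real.norm_of_nonneg hε.le] at h4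
  simp only [zero_add] at h1
  rw [pow_succ', mul_assoc]
  exact (mul_le_mul_of_nonneg_left h1 (by linarith)).trans h2

theorem pow_mul_sq_norm_sub_zero_le (hκ : 0 ≤ κ) (hε : 0 < ε) (hθ : 4 * κ * ε ≤ 1)
    (hX : IsEulerOrbit C φ κ ε X) {p : H} (hp : IsSemisubgradient C φ κ (X 0) p) (n : ℕ) :
    (1 - 2 * κ * ε) ^ n * ‖X n - X 0‖ ^ 2 ≤ ‖p‖ ^ 2 * (n * ε) ^ 2 := by
  have hκε := mul_nonneg hκ hε.le
  have hθ0 : 0 < 1 - 2 * κ * ε := by linarith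
  have hP : 0 < (1 - 2 * κ * ε) ^ n := pow_pos hθ0 n
  have h1 : ‖X n - X 0‖ ≤ ((n : ℝ) - (0 : ℕ)) * (ε * ‖p‖ / √((1 - 2 * κ * ε) ^ n)) := by
    refine norm_sub_le_mul_of_forall_succ n.zero_le fun k _ hk => ?_
    rw [le_div_iff₀ (Real.sqrt_pos.2 hP)]
    refine le_of_sq_le_sq ?_ (by positivity)
    rw [mul_pow, Real.sq_sqrt hP.le, mul_comm]
    refine le_trans ?_ (pow_mul_sq_norm_succ_sub_le_of_subgradient hε (by linarith) hX hp k)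
    refine mul_le_mul_of_nonneg_right ?_ (sq_nonneg _)
    exact pow_le_pow_of_le_one hθ0.le (by linarith) hk
  calc (1 - 2 * κ * ε) ^ n * ‖X n - X 0‖ ^ 2
      ≤ (1 - 2 * κ * ε) ^ n * (((n : ℝ) - (0 : ℕ)) * (ε * ‖p‖ / √((1 - 2 * κ * ε) ^ n))) ^ 2 := by
        gcongr
    _ = ‖p‖ ^ 2 * (n * ε) ^ 2 := by
        rw [mul_pow, div_pow, Real.sq_sqrt hP.le]
        field_simp
        simp

/-- Comparison of two orbits with different steps and a common starting point. -/
theorem pow_mul_pow_mul_sq_norm_sub_le (hκ : 0 ≤ κ) (hε : 0 < ε) (hεκ : 4 * κ * ε ≤ 1)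
    (hδ : 0 < δ) (hδκ : 4 * κ * δ ≤ 1) (hX : IsEulerOrbit C φ κ ε X)
    (hY : IsEulerOrbit C φ κ δ Y) (hXY : X 0 = Y 0) {p : H}
    (hp : IsSemisubgradient C φ κ (X 0) p) (m n : ℕ) :
    (1 - 2 * κ * ε) ^ m * (1 - 2 * κ * δ) ^ n * ‖X m - Y n‖ ^ 2 ≤
      ‖p‖ ^ 2 * ((m * ε - n * δ) ^ 2 + m * ε ^ 2 + n * δ ^ 2) := by
  have hκε := mul_nonneg hκ hε.le
  have hκδ := mul_nonneg hκ hδ.le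
  have ha : 0 < 1 - 2 * κ * ε := by linarith
  have hb : 0 < 1 - 2 * κ * δ := by linarith
  induction m generalizing n with
  | zero =>
    have h1 := pow_mul_sq_norm_sub_zero_le hκ hδ hδκ hY (hXY ▸ hp) n
    rw [hXY, norm_sub_rev]
    simp only [pow_zero, one_mul, Nat.cast_zero, zero_mul, zero_sub, neg_sq, add_zero]
    refine h1.trans ?_
    gcongr
    have : 0 ≤ (n : ℝ) * δ ^ 2 := by positivity
    linarith
  | succ m ihm =>
    induction n with
    | zero =>
      have h1 := pow_mul_sq_norm_sub_zero_le hκ hε hεκ hX hp (m + 1)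
      rw [← hXY]
      simp only [pow_zero, mul_one, Nat.cast_zero, zero_mul, sub_zero, add_zero]
      refine h1.trans ?_
      gcongr
      have : 0 ≤ ((m + 1 : ℕ) : ℝ) * ε ^ 2 := by positivity
      linarith
    | succ n ihn =>
      have h1 := ihm (n + 1)
      have h2 := (hX m).two_step_sq_le hε hδ (hY n)
      have hpos : 0 < ε + δ - 2 * κ * ε * δ := by nlinarith
      have hP : 0 ≤ (1 - 2 * κ * ε) ^ m * (1 - 2 * κ * δ) ^ n := by positivity
      have h3 := mul_le_mul_of_nonneg_left h2
        (mul_nonneg hP (mul_nonneg ha.le hb.le))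
      have h4 := mul_le_mul_of_nonneg_left h1 (mul_nonneg hδ.le ha.le)
      have h5 := mul_le_mul_of_nonneg_left ihn (mul_nonneg hε.le hb.le)
      refine le_of_mul_le_mul_left ?_ hpos
      -- The majorant `(mε - nδ)² + mε² + nδ²` satisfies the two-step recursion with equality when
      -- `κ = 0`; the terms in `κ` leave twice the nonnegative quantity `h7`.
      have h6 : δ * (1 - 2 * κ * ε) *
            ((m * ε - (n + 1 : ℕ) * δ) ^ 2 + m * ε ^ 2 + (n + 1 : ℕ) * δ ^ 2) +
          ε * (1 - 2 * κ * δ) *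
            (((m + 1 : ℕ) * ε - n * δ) ^ 2 + (m + 1 : ℕ) * ε ^ 2 + n * δ ^ 2) ≤
          (ε + δ - 2 * κ * ε * δ) * (((m + 1 : ℕ) * ε - (n + 1 : ℕ) * δ) ^ 2 +
            (m + 1 : ℕ) * ε ^ 2 + (n + 1 : ℕ) * δ ^ 2) := by
        push_cast
        have h7 : 0 ≤ κ * ε * δ * ((m * ε - n * δ + (ε - δ) + (δ - ε)) ^ 2 + 2 * ε * δ
            + m * ε ^ 2 + n * δ ^ 2) := by positivity
        nlinarith
      have h8 := mul_le_mul_of_nonneg_left h6 (sq_nonneg ‖p‖)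
      rw [pow_succ, pow_succ] at *
      linarith

end IsEulerOrbit

end EulerOrbits

/-! ### Energy decay and discrete velocity bounds. -/

section EulerEnergy

variable {H : Type*} [NormedAddCommGroup H] [InnerProductSpace ℝ H]
variable {C : Set H} {φ : H → ℝ} {κ ε : ℝ} {X : ℕ → H}

namespace IsEulerOrbit

/-- The discrete variational inequality with `v = X n`. The bound `1 ≤ n` ensures `X n ∈ C`, since
the starting point may lie only in the closure. -/
theorem energy_succ_le (hε : 0 < ε) (hεκ : κ * ε ≤ 1) (hX : IsEulerOrbit C φ κ ε X) {n : ℕ}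
    (hn : 1 ≤ n) : ‖X (n + 1) - X n‖ ^ 2 ≤ 2 * ε * (φ (X n) - φ (X (n + 1))) := by
  obtain ⟨n, rfl⟩ := Nat.exists_eq_add_of_le' hn
  have h1 := (hX (n + 1)).sq_norm_sub_le hε (hX n).1
  rw [sub_self, norm_zero, norm_sub_rev (X (n + 1)) (X (n + 1 + 1))] at h1
  have h2 : κ * ε * ‖X (n + 1 + 1) - X (n + 1)‖ ^ 2 ≤ 1 * ‖X (n + 1 + 1) - X (n + 1)‖ ^ 2 := by
    gcongr
  linarith

theorem energy_antitone (hε : 0 < ε) (hεκ : κ * ε ≤ 1) (hX : IsEulerOrbit C φ κ ε X) {n : ℕ}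
    (hn : 1 ≤ n) : φ (X (n + 1)) ≤ φ (X n) := by
  have h1 := energy_succ_le hε hεκ hX hn
  have h2 : 0 ≤ 2 * ε * (φ (X n) - φ (X (n + 1))) := (sq_nonneg _).trans h1
  linarith [nonneg_of_mul_nonneg_right h2 (by positivity)]

/-- The discrete variational inequalities are summed over the steps; as the energy decreases, each
`φ (X k)` may be replaced by the last one. -/
theorem sq_norm_sub_le_of_le (hκ : 0 ≤ κ) (hε : 0 < ε) (hεκ : κ * ε ≤ 1)
    (hX : IsEulerOrbit C φ κ ε X) {v : H} (hv : v ∈ C) {ρ : ℝ} {m n : ℕ} (hmn : m ≤ n)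
    (hρ : ∀ k, m ≤ k → k ≤ n → ‖X k - v‖ ≤ ρ) :
    ‖X n - v‖ ^ 2 - ‖X m - v‖ ^ 2 ≤
      ((n : ℝ) - m) * ε * (2 * (φ v - φ (X n)) + κ * ρ ^ 2) := by
  induction n, hmn using Nat.le_induction with
  | base => simp
  | succ n hmn ih =>
    have h1 := ih fun k hk hk' => hρ k hk (hk'.trans n.le_succ)
    have h2 := (hX n).sq_norm_sub_le hε hv
    have h3 : κ * ε * ‖X (n + 1) - v‖ ^ 2 ≤ κ * ε * ρ ^ 2 := by
      have := hρ (n + 1) (by lia) le_rfl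
      gcongr
    have h4 : 0 ≤ ((n : ℝ) - m) * ε * (φ (X n) - φ (X (n + 1))) := by
      -- The energy need not decrease from `X 0`, possibly outside `C`, but then `n - m = 0`.
      rcases Nat.eq_zero_or_pos n with rfl | hn
      · obtain rfl : m = 0 := by lia
        simp
      · have h5 := energy_antitone hε hεκ hX hn
        have h6 : (m : ℝ) ≤ n := by exact_mod_cast hmn
        exact mul_nonneg (mul_nonneg (by linarith) hε.le) (by linarith)
    have h7 := sq_nonneg ‖X n - X (n + 1)‖
    push_cast
    linarith

/-- The squared step lengths sum to at most `2ε` times the energy drop and are almost nonincreasing,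
so the last of `k + 1` is at most about the average. -/
theorem pow_mul_sq_norm_succ_sub_le_energy (hκ : 0 ≤ κ) (hε : 0 < ε) (hεκ : 4 * κ * ε ≤ 1)
    (hX : IsEulerOrbit C φ κ ε X) {N : ℕ} (hN : 1 ≤ N) (k : ℕ) :
    (1 - 2 * κ * ε) ^ k * ((k + 1) * ‖X (N + k + 1) - X (N + k)‖ ^ 2) ≤
      2 * ε * (φ (X N) - φ (X (N + k + 1))) := by
  have hκε := mul_nonneg hκ hε.le
  induction k with
  | zero => simpa using energy_succ_le hε (by linarith) hX hN
  | succ k ih =>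
    have h1 := (hX (N + k + 1)).step_sq_le hε (hX (N + k))
    have h2 := energy_succ_le hε (by linarith) hX (n := N + k + 1) (by lia)
    have hθ : 0 ≤ 1 - 2 * κ * ε := by linarith
    have h3 : (1 - 2 * κ * ε) ^ (k + 1) * ‖X (N + k + 1 + 1) - X (N + k + 1)‖ ^ 2 ≤
        1 * ‖X (N + k + 1 + 1) - X (N + k + 1)‖ ^ 2 := by
      gcongr
      exact pow_le_one₀ hθ (by linarith)
    have h4 := mul_le_mul_of_nonneg_left h1
      (mul_nonneg (pow_nonneg hθ k) (by positivity : (0 : ℝ) ≤ k + 1))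
    rw [← add_assoc N k 1]
    push_cast
    calc _ = (1 - 2 * κ * ε) ^ k * (k + 1) *
            ((1 - 2 * κ * ε) * ‖X (N + k + 1 + 1) - X (N + k + 1)‖ ^ 2) +
          (1 - 2 * κ * ε) ^ (k + 1) * ‖X (N + k + 1 + 1) - X (N + k + 1)‖ ^ 2 := by ring
      _ ≤ _ := by linarith

end IsEulerOrbit

theorem eventually_step_small (κ : ℝ) {r : ℝ} (hr : 0 < r) :
    ∀ᶠ ε in 𝓝[>] (0 : ℝ), 0 < ε ∧ 4 * κ * ε ≤ 1 ∧ ε ≤ r := by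
  have h1 : ∀ᶠ ε in 𝓝 (0 : ℝ), 4 * κ * ε < 1 :=
    (Continuous.tendsto (f := fun ε : ℝ => 4 * κ * ε) (by fun_prop) 0).eventually
      (gt_mem_nhds (by norm_num))
  filter_upwards [Ioc_mem_nhdsGT hr, h1.filter_mono nhdsWithin_le_nhds] with ε hε hε'
  exact ⟨hε.1, hε'.le, hε.2⟩

namespace IsClosedSemiconvex

variable [CompleteSpace H]

/-- The orbit is compared with one started at a nearby point having a subgradient, whose
displacement is bounded linearly in time. -/
theorem exists_norm_eulerOrbit_le (h : IsClosedSemiconvex C φ κ) (hκ : 0 ≤ κ) {x : H}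
    (hx : x ∈ closure C) {W : ℝ → ℕ → H}
    (hW : ∀ᶠ ε in 𝓝[>] (0 : ℝ), W ε 0 = x ∧ IsEulerOrbit C φ κ ε (W ε)) (τ : ℝ) :
    ∃ B, 0 ≤ B ∧ ∀ᶠ ε in 𝓝[>] (0 : ℝ), ∀ n : ℕ, n * ε ≤ τ → ‖W ε n‖ ≤ B := by
  obtain ⟨y, p, hp, -⟩ := h.exists_isSemisubgradient_near hκ hx one_pos
  obtain ⟨V, hV⟩ := h.exists_eulerOrbit_family hκ y
  refine ⟨Real.exp (2 * κ * τ) * ‖x - y‖ + Real.exp (2 * κ * τ) * (‖p‖ * |τ|) + ‖y‖,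
    by positivity, ?_⟩
  filter_upwards [hW, hV, eventually_step_small κ one_pos] with ε hWε hVε hε n hn
  have h1 := IsEulerOrbit.norm_sub_le hκ hε.1 hε.2.1 hWε.2 hVε.2.1 hn
  rw [hWε.1, hVε.1] at h1
  have h2 : ‖V ε n - y‖ ≤ Real.exp (2 * κ * τ) * (‖p‖ * |τ|) := by
    have h3 := IsEulerOrbit.pow_mul_sq_norm_sub_zero_le hκ hε.1 hε.2.1 hVε.2.1
      (hVε.1.symm ▸ hp) n
    have h4 := Real.exp_neg_le_one_sub_pow hκ hε.1.le hε.2.1 hn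
    rw [hVε.1] at h3
    refine le_of_sq_le_sq ?_ (by positivity)
    have h5 : Real.exp (-(4 * κ * τ)) * ‖V ε n - y‖ ^ 2 ≤ (‖p‖ * |τ|) ^ 2 := by
      refine (mul_le_mul_of_nonneg_right h4 (sq_nonneg _)).trans (h3.trans ?_)
      rw [mul_pow ‖p‖]
      have := hε.1
      gcongr
      exact hn.trans (le_abs_self _)
    have h6 : Real.exp (2 * κ * τ) ^ 2 * Real.exp (-(4 * κ * τ)) = 1 := by
      rw [← Real.exp_nat_mul, ← Real.exp_add, Real.exp_eq_one_iff]
      push_cast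
      ring
    calc ‖V ε n - y‖ ^ 2 = Real.exp (2 * κ * τ) ^ 2 *
          (Real.exp (-(4 * κ * τ)) * ‖V ε n - y‖ ^ 2) := by rw [← mul_assoc, h6, one_mul]
      _ ≤ Real.exp (2 * κ * τ) ^ 2 * (‖p‖ * |τ|) ^ 2 := by gcongr
      _ = _ := by ring
  calc ‖W ε n‖ = ‖(W ε n - V ε n) + (V ε n - y) + y‖ := by congr 1; abel
    _ ≤ ‖W ε n - V ε n‖ + ‖V ε n - y‖ + ‖y‖ := norm_add₃_le
    _ ≤ _ := by gcongr

/-- Regularizing effect: away from the initial time the discrete velocities are bounded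
uniformly in the step. -/
theorem exists_norm_eulerOrbit_succ_sub_le (h : IsClosedSemiconvex C φ κ) (hκ : 0 ≤ κ) {x : H}
    (hx : x ∈ closure C) {W : ℝ → ℕ → H}
    (hW : ∀ᶠ ε in 𝓝[>] (0 : ℝ), W ε 0 = x ∧ IsEulerOrbit C φ κ ε (W ε)) {τ T : ℝ} (hτ : 0 < τ)
    (hT : 0 ≤ T) :
    ∃ K, 0 ≤ K ∧ ∀ᶠ ε in 𝓝[>] (0 : ℝ), ∀ j : ℕ, τ ≤ j * ε → j * ε ≤ T →
      ‖W ε (j + 1) - W ε j‖ ≤ K * ε := by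
  obtain ⟨v, hv⟩ := h.nonempty
  obtain ⟨M, hM0, hM⟩ := h.exists_quadratic_lower_bound hκ
  obtain ⟨B, hB0, hB⟩ := h.exists_norm_eulerOrbit_le hκ hx hW (T + 1)
  set B' := B + ‖v‖ with hB'
  set P := |φ v| + 2 * (1 + κ * T) * B' ^ 2 / τ with hP
  set Q := P + M * (1 + B ^ 2) with hQ
  have hP0 : 0 ≤ P := by positivity
  have hQ0 : 0 ≤ Q := by positivity
  refine ⟨√(4 * Q * Real.exp (4 * κ * T) / τ), Real.sqrt_nonneg _, ?_⟩
  filter_upwards [hW, hB, eventually_step_small κ one_pos,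
    eventually_step_small κ (half_pos hτ)] with ε hWε hBε hε hετ j hj hjT
  have hε0 := hε.1
  have hκε := mul_nonneg hκ hε0.le
  have hj2 : 2 ≤ j := by
    by_contra! hcon
    have : (j : ℝ) ≤ 1 := by exact_mod_cast Nat.le_of_lt_succ hcon
    nlinarith [hετ.2.2]
  -- The `j` steps are split in two halves: the first brings the energy below a bound `P`
  -- independent of `ε`, the second turns the energy bound into a bound on the step length. Both
  -- last a time comparable to `τ`.
  obtain ⟨N, k, rfl, hN1, hN4, hk2⟩ :
      ∃ N k, j = N + k ∧ 1 ≤ N ∧ N + k ≤ 4 * N ∧ N + k ≤ 2 * k :=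
    ⟨j / 2, j - j / 2, by lia, by lia, by lia, by lia⟩
  have hN4' : ((N + k : ℕ) : ℝ) ≤ 4 * N := by exact_mod_cast hN4
  have hk2' : ((N + k : ℕ) : ℝ) ≤ 2 * k := by exact_mod_cast hk2
  have hle : ∀ i : ℕ, i ≤ N + k + 1 → (i : ℝ) * ε ≤ T + 1 := by
    intro i hi
    have : (i : ℝ) ≤ (N + k : ℕ) + 1 := by exact_mod_cast hi
    nlinarith [hε.2.2]
  have hNε : τ / 4 ≤ N * ε := by nlinarith
  have hNT : N * ε ≤ T := by
    refine le_trans ?_ hjT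
    gcongr
    lia
  have hkT : k * ε ≤ T := by
    refine le_trans ?_ hjT
    gcongr
    lia
  have hφN : φ (W ε N) ≤ P := by
    have h1 := hWε.2.sq_norm_sub_le_of_le hκ hε0 (by linarith) hv (ρ := B') (m := 0) (n := N)
      N.zero_le fun i _ hi => (_root_.norm_sub_le _ _).trans
        (add_le_add_left (hBε i (hle i (by lia))) _)
    have h2 : ‖W ε 0 - v‖ ^ 2 ≤ B' ^ 2 := by
      gcongr
      exact (_root_.norm_sub_le _ _).trans (add_le_add_left (hBε 0 (hle 0 (by lia))) _)
    have h3 : N * ε * (2 * (φ (W ε N) - φ v)) ≤ (1 + κ * T) * B' ^ 2 := by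
      have h4 : κ * (N * ε) * B' ^ 2 ≤ κ * T * B' ^ 2 := by gcongr
      have h5 := sq_nonneg ‖W ε N - v‖
      simp only [Nat.cast_zero, sub_zero] at h1
      linarith
    rw [hP]
    by_contra! hcon
    have h6 : 2 * (1 + κ * T) * B' ^ 2 / τ < φ (W ε N) - φ v := by
      linarith [le_abs_self (φ v)]
    have h7 : 0 ≤ 2 * (1 + κ * T) * B' ^ 2 / τ := by positivity
    have h8 : τ / 4 * (2 * (φ (W ε N) - φ v)) ≤ N * ε * (2 * (φ (W ε N) - φ v)) :=
      mul_le_mul_of_nonneg_right hNε (by linarith)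
    rw [div_lt_iff₀ hτ] at h6
    linarith
  have hφj : -(M * (1 + B ^ 2)) ≤ φ (W ε (N + k + 1)) := by
    refine le_trans ?_ (hM _ (hWε.2 (N + k)).1)
    have := hBε (N + k + 1) (hle _ le_rfl)
    gcongr
  have h1 := hWε.2.pow_mul_sq_norm_succ_sub_le_energy hκ hε0 hε.2.1 hN1 k
  have h2 := Real.exp_neg_le_one_sub_pow hκ hε0.le hε.2.1 hkT
  set D := ‖W ε (N + k + 1) - W ε (N + k)‖ with hD
  have h3 : Real.exp (-(4 * κ * T)) * (((k : ℝ) + 1) * D ^ 2) ≤ 2 * ε * Q := by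
    refine (mul_le_mul_of_nonneg_right h2 (by positivity)).trans (h1.trans ?_)
    gcongr
    linarith
  have h4 : τ / 2 * D ^ 2 ≤ ε * (((k : ℝ) + 1) * D ^ 2) := by
    rw [← mul_assoc]
    gcongr
    nlinarith
  have h5 : τ / 2 * D ^ 2 ≤ Real.exp (4 * κ * T) * (2 * ε ^ 2 * Q) := by
    have h6 : Real.exp (4 * κ * T) * Real.exp (-(4 * κ * T)) = 1 := by
      rw [← Real.exp_add, add_neg_cancel, Real.exp_zero]
    calc τ / 2 * D ^ 2 ≤ ε * (((k : ℝ) + 1) * D ^ 2) := h4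
      _ = ε * (Real.exp (4 * κ * T) * (Real.exp (-(4 * κ * T)) * (((k : ℝ) + 1) * D ^ 2))) := by
        rw [← mul_assoc (Real.exp _), h6, one_mul]
      _ ≤ ε * (Real.exp (4 * κ * T) * (2 * ε * Q)) := by gcongr
      _ = _ := by ring
  refine le_of_sq_le_sq ?_ (by positivity)
  rw [mul_pow, Real.sq_sqrt (by positivity), div_mul_eq_mul_div, le_div_iff₀ hτ]
  linarith

end IsClosedSemiconvex

end EulerEnergy

/-! ### Convergence of the scheme and properties of its limits. -/

section EulerLimits

theorem tendsto_floor_div_mul {t : ℝ} (ht : 0 ≤ t) :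
    Tendsto (fun ε : ℝ => (⌊t / ε⌋₊ : ℝ) * ε) (𝓝[>] 0) (𝓝 t) := by
  have h1 : Tendsto (fun ε : ℝ => t - ε) (𝓝[>] 0) (𝓝 t) := by
    refine tendsto_nhdsWithin_of_tendsto_nhds ?_
    simpa using (Continuous.tendsto (f := fun ε : ℝ => t - ε) (by fun_prop) 0)
  refine tendsto_of_tendsto_of_tendsto_of_le_of_le' h1 tendsto_const_nhds ?_ ?_
  · filter_upwards [self_mem_nhdsWithin] with ε hε
    have h2 := Nat.lt_floor_add_one (t / ε)
    rw [div_lt_iff₀ hε] at h2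
    linarith
  · filter_upwards [self_mem_nhdsWithin] with ε hε
    have h2 := Nat.floor_le (div_nonneg ht (le_of_lt hε))
    rwa [le_div_iff₀ hε] at h2

theorem floor_div_mul_le {t ε : ℝ} (ht : 0 ≤ t) (hε : 0 < ε) : (⌊t / ε⌋₊ : ℝ) * ε ≤ t := by
  have h2 := Nat.floor_le (div_nonneg ht hε.le)
  rwa [le_div_iff₀ hε] at h2

theorem sub_le_floor_div_mul (t : ℝ) {ε : ℝ} (hε : 0 < ε) : t - ε ≤ (⌊t / ε⌋₊ : ℝ) * ε := by
  have h2 := Nat.lt_floor_add_one (t / ε)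
  rw [div_lt_iff₀ hε] at h2
  linarith

variable {H : Type*} [NormedAddCommGroup H] [InnerProductSpace ℝ H]
variable {C : Set H} {φ : H → ℝ} {κ : ℝ}

theorem IsEulerOrbit.norm_sub_floor_le {ε δ t : ℝ} (hκ : 0 ≤ κ) (hε : 0 < ε)
    (hεκ : 4 * κ * ε ≤ 1) (hδ : 0 < δ) (hδκ : 4 * κ * δ ≤ 1) (ht : 0 ≤ t) {X Y : ℕ → H}
    (hX : IsEulerOrbit C φ κ ε X) (hY : IsEulerOrbit C φ κ δ Y) (hXY : X 0 = Y 0) {p : H}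
    (hp : IsSemisubgradient C φ κ (X 0) p) :
    ‖X ⌊t / ε⌋₊ - Y ⌊t / δ⌋₊‖ ^ 2 ≤
      Real.exp (8 * κ * t) * (‖p‖ ^ 2 * ((ε + δ) ^ 2 + t * (ε + δ))) := by
  set m := ⌊t / ε⌋₊
  set n := ⌊t / δ⌋₊
  have hm : m * ε ≤ t := floor_div_mul_le ht hε
  have hn : n * δ ≤ t := floor_div_mul_le ht hδ
  have hm' : t - ε ≤ m * ε := sub_le_floor_div_mul t hε
  have hn' : t - δ ≤ n * δ := sub_le_floor_div_mul t hδ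
  have h1 := hX.pow_mul_pow_mul_sq_norm_sub_le hκ hε hεκ hδ hδκ hY hXY hp m n
  have h2 := mul_le_mul (Real.exp_neg_le_one_sub_pow hκ hε.le hεκ hm)
    (Real.exp_neg_le_one_sub_pow hκ hδ.le hδκ hn) (Real.exp_pos _).le
    (pow_nonneg (by nlinarith [mul_nonneg hκ hε.le]) _)
  rw [← Real.exp_add, show -(4 * κ * t) + -(4 * κ * t) = -(8 * κ * t) by ring] at h2
  have h3 : ‖p‖ ^ 2 * ((m * ε - n * δ) ^ 2 + m * ε ^ 2 + n * δ ^ 2) ≤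
      ‖p‖ ^ 2 * ((ε + δ) ^ 2 + t * (ε + δ)) := by
    have h4 : (m * ε - n * δ) ^ 2 ≤ (ε + δ) ^ 2 := sq_le_sq' (by linarith) (by linarith)
    have h5 : m * ε * ε ≤ t * ε := by gcongr
    have h6 : n * δ * δ ≤ t * δ := by gcongr
    exact mul_le_mul_of_nonneg_left (by linarith) (sq_nonneg _)
  calc ‖X m - Y n‖ ^ 2
      = Real.exp (8 * κ * t) * (Real.exp (-(8 * κ * t)) * ‖X m - Y n‖ ^ 2) := by
        rw [← mul_assoc, ← Real.exp_add, add_neg_cancel, Real.exp_zero, one_mul]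
    _ ≤ _ := mul_le_mul_of_nonneg_left
        ((mul_le_mul_of_nonneg_right h2 (sq_nonneg _)).trans (h1.trans h3)) (Real.exp_pos _).le

/-- `u` is the pointwise limit on `[0, ∞)` of implicit Euler orbits started at `x`. -/
def IsEulerLimit (C : Set H) (φ : H → ℝ) (κ : ℝ) (x : H) (u : ℝ → H) : Prop :=
  ∃ W : ℝ → ℕ → H, (∀ᶠ ε in 𝓝[>] (0 : ℝ), W ε 0 = x ∧ IsEulerOrbit C φ κ ε (W ε)) ∧
    ∀ t, 0 ≤ t → Tendsto (fun ε => W ε ⌊t / ε⌋₊) (𝓝[>] (0 : ℝ)) (𝓝 (u t))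

namespace IsEulerLimit

theorem apply_zero {x : H} {u : ℝ → H} (hu : IsEulerLimit C φ κ x u) : u 0 = x := by
  obtain ⟨W, hW, hlim⟩ := hu
  refine tendsto_nhds_unique (hlim 0 le_rfl) (tendsto_const_nhds.congr' ?_)
  filter_upwards [hW] with ε hε
  simp [hε.1]

theorem norm_sub_le {x y : H} {u v : ℝ → H} (hκ : 0 ≤ κ) (hu : IsEulerLimit C φ κ x u)
    (hv : IsEulerLimit C φ κ y v) {t : ℝ} (ht : 0 ≤ t) :
    ‖u t - v t‖ ≤ Real.exp (2 * κ * t) * ‖x - y‖ := by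
  obtain ⟨W, hW, hWlim⟩ := hu
  obtain ⟨V, hV, hVlim⟩ := hv
  refine le_of_tendsto ((hWlim t ht).sub (hVlim t ht)).norm ?_
  filter_upwards [hW, hV, eventually_step_small κ one_pos] with ε hWε hVε hε
  have := hWε.2.norm_sub_le hκ hε.1 hε.2.1 hVε.2 (floor_div_mul_le ht hε.1)
  rwa [hWε.1, hVε.1] at this

end IsEulerLimit

namespace IsClosedSemiconvex

variable [CompleteSpace H]

/-- From a start `y` with a subgradient, orbits of steps `ε` and `δ` differ by a quantity vanishing
with the steps. A general `x` is approximated by such `y`, the contraction making the error uniform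
in the step. -/
theorem exists_isEulerLimit (h : IsClosedSemiconvex C φ κ) (hκ : 0 ≤ κ) {x : H}
    (hx : x ∈ closure C) {W : ℝ → ℕ → H}
    (hW : ∀ᶠ ε in 𝓝[>] (0 : ℝ), W ε 0 = x ∧ IsEulerOrbit C φ κ ε (W ε)) :
    ∃ u : ℝ → H, ∀ t, 0 ≤ t → Tendsto (fun ε => W ε ⌊t / ε⌋₊) (𝓝[>] (0 : ℝ)) (𝓝 (u t)) := by
  have key : ∀ t, 0 ≤ t → ∃ z, Tendsto (fun ε => W ε ⌊t / ε⌋₊) (𝓝[>] (0 : ℝ)) (𝓝 z) := by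
    intro t ht
    refine cauchy_map_iff_exists_tendsto.1 (cauchy_map_iff.2 ⟨inferInstance, ?_⟩)
    rw [Metric.uniformity_basis_dist.tendsto_right_iff]
    intro η hη
    obtain ⟨y, p, hp, hxy⟩ := h.exists_isSemisubgradient_near hκ hx
      (η := η / 3 / Real.exp (2 * κ * t)) (by positivity)
    rw [lt_div_iff₀ (Real.exp_pos _), mul_comm] at hxy
    obtain ⟨V, hV⟩ := h.exists_eulerOrbit_family hκ y
    have hsmall : ∀ᶠ q : ℝ × ℝ in 𝓝[>] (0 : ℝ) ×ˢ 𝓝[>] (0 : ℝ),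
        Real.exp (8 * κ * t) * (‖p‖ ^ 2 * ((q.1 + q.2) ^ 2 + t * (q.1 + q.2))) < (η / 3) ^ 2 := by
      have h1 : Tendsto (fun q : ℝ × ℝ => Real.exp (8 * κ * t) *
          (‖p‖ ^ 2 * ((q.1 + q.2) ^ 2 + t * (q.1 + q.2)))) (𝓝 (0, 0)) (𝓝 0) :=
        Continuous.tendsto' (by fun_prop) _ _ (by simp)
      refine (h1.mono_left ?_).eventually (gt_mem_nhds (by positivity))
      rw [nhds_prod_eq]
      exact prod_mono nhdsWithin_le_nhds nhdsWithin_le_nhds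
    have hev := (hW.and hV).and (eventually_step_small κ one_pos)
    filter_upwards [hev.prod_mk hev, hsmall] with q hq hqs
    obtain ⟨⟨⟨hW1, hV1⟩, hε⟩, ⟨⟨hW2, hV2⟩, hδ⟩⟩ := hq
    have h1 := hW1.2.norm_sub_le hκ hε.1 hε.2.1 hV1.2.1 (floor_div_mul_le ht hε.1)
    have h2 := hW2.2.norm_sub_le hκ hδ.1 hδ.2.1 hV2.2.1 (floor_div_mul_le ht hδ.1)
    rw [hW1.1, hV1.1] at h1
    rw [hW2.1, hV2.1] at h2
    have h3 := hV1.2.1.norm_sub_floor_le hκ hε.1 hε.2.1 hδ.1 hδ.2.1 ht hV2.2.1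
      (hV1.1.trans hV2.1.symm) (hV1.1.symm ▸ hp)
    have h4 := lt_of_pow_lt_pow_left₀ 2 (by positivity) (h3.trans_lt hqs)
    rw [norm_sub_rev (W q.2 _)] at h2
    show dist (W q.1 ⌊t / q.1⌋₊) (W q.2 ⌊t / q.2⌋₊) < η
    rw [dist_eq_norm]
    calc ‖W q.1 ⌊t / q.1⌋₊ - W q.2 ⌊t / q.2⌋₊‖
        = ‖(W q.1 ⌊t / q.1⌋₊ - V q.1 ⌊t / q.1⌋₊) + (V q.1 ⌊t / q.1⌋₊ - V q.2 ⌊t / q.2⌋₊) +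
            (V q.2 ⌊t / q.2⌋₊ - W q.2 ⌊t / q.2⌋₊)‖ := by congr 1; abel
      _ ≤ _ := norm_add₃_le
      _ < η := by linarith
  choose! u hu using key
  exact ⟨u, hu⟩

end IsClosedSemiconvex

namespace IsEulerLimit

/-- An Euler limit started at a point of subdifferentiability is Lipschitz. -/
theorem norm_sub_le_of_subgradient {x p : H} {u : ℝ → H} (hκ : 0 ≤ κ)
    (hu : IsEulerLimit C φ κ x u) (hp : IsSemisubgradient C φ κ x p) {s t T : ℝ}
    (hs : 0 ≤ s) (hst : s ≤ t) (ht : t ≤ T) :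
    ‖u t - u s‖ ≤ Real.exp (2 * κ * (T + 1)) * ‖p‖ * (t - s) := by
  obtain ⟨W, hW, hlim⟩ := hu
  have h0t := hs.trans hst
  have h1 : Tendsto (fun ε : ℝ => Real.exp (2 * κ * (T + 1)) * ‖p‖ *
      ((⌊t / ε⌋₊ : ℝ) * ε - (⌊s / ε⌋₊ : ℝ) * ε)) (𝓝[>] 0)
      (𝓝 (Real.exp (2 * κ * (T + 1)) * ‖p‖ * (t - s))) :=
    ((tendsto_floor_div_mul h0t).sub (tendsto_floor_div_mul hs)).const_mul _
  refine le_of_tendsto_of_tendsto ((hlim t h0t).sub (hlim s hs)).norm h1 ?_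
  filter_upwards [hW, eventually_step_small κ one_pos] with ε hWε hε
  have hε0 := hε.1
  have hfl : ⌊s / ε⌋₊ ≤ ⌊t / ε⌋₊ := Nat.floor_le_floor (by gcongr)
  refine (norm_sub_le_mul_of_forall_succ hfl (s := Real.exp (2 * κ * (T + 1)) * ‖p‖ * ε)
    fun k _ hk => ?_).trans (le_of_eq (by ring))
  have h2 := hWε.2.pow_mul_sq_norm_succ_sub_le_of_subgradient hε0
    (by nlinarith [mul_nonneg hκ hε0.le]) (hWε.1.symm ▸ hp) k
  have hkT : ((k + 1 : ℕ) : ℝ) * ε ≤ T + 1 := by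
    have h3 : ((k + 1 : ℕ) : ℝ) * ε ≤ ⌊t / ε⌋₊ * ε := by
      gcongr
      exact hk
    linarith [floor_div_mul_le h0t hε0]
  have h4 := Real.exp_neg_le_one_sub_pow hκ hε0.le hε.2.1 hkT
  refine le_of_sq_le_sq ?_ (by positivity)
  have h6 : Real.exp (2 * κ * (T + 1)) ^ 2 * Real.exp (-(4 * κ * (T + 1))) = 1 := by
    rw [← Real.exp_nat_mul, ← Real.exp_add, Real.exp_eq_one_iff]
    push_cast
    ring
  calc ‖W ε (k + 1) - W ε k‖ ^ 2 = Real.exp (2 * κ * (T + 1)) ^ 2 *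
        (Real.exp (-(4 * κ * (T + 1))) * ‖W ε (k + 1) - W ε k‖ ^ 2) := by
        rw [← mul_assoc, h6, one_mul]
    _ ≤ Real.exp (2 * κ * (T + 1)) ^ 2 * (ε * ‖p‖) ^ 2 := by
        gcongr
        exact (mul_le_mul_of_nonneg_right h4 (sq_nonneg _)).trans h2
    _ = _ := by ring

variable [CompleteSpace H]

/-- On `[0, T]` the curve is a uniform limit of Lipschitz Euler limits, those started at nearby
points with a subgradient. -/
theorem continuousOn (h : IsClosedSemiconvex C φ κ) (hκ : 0 ≤ κ) {x : H} (hx : x ∈ closure C)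
    {u : ℝ → H} (hu : IsEulerLimit C φ κ x u) (T : ℝ) : ContinuousOn u (Icc 0 T) := by
  rw [Metric.continuousOn_iff]
  intro t ht η hη
  obtain ⟨y, p, hp, hxy⟩ := h.exists_isSemisubgradient_near hκ hx
    (η := η / 3 / Real.exp (2 * κ * T)) (by positivity)
  rw [lt_div_iff₀ (Real.exp_pos _), mul_comm] at hxy
  obtain ⟨V, hV⟩ := h.exists_eulerOrbit_family hκ y
  have hV' := hV.mono fun ε hε => And.intro hε.1 hε.2.1
  obtain ⟨v, hv⟩ := h.exists_isEulerLimit hκ (subset_closure hp.1) hV'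
  have hvl : IsEulerLimit C φ κ y v := ⟨V, hV', hv⟩
  have huv : ∀ s ∈ Icc 0 T, ‖u s - v s‖ < η / 3 := by
    intro s hs
    refine (hu.norm_sub_le hκ hvl hs.1).trans_lt (lt_of_le_of_lt ?_ hxy)
    gcongr
    exact hs.2
  set L := Real.exp (2 * κ * (T + 1)) * ‖p‖ with hL
  have hL0 : 0 ≤ L := by positivity
  have hlip : ∀ s ∈ Icc 0 T, ‖v s - v t‖ ≤ L * |s - t| := by
    intro s hs
    rcases le_total t s with hts | hst
    · rw [abs_of_nonneg (sub_nonneg.2 hts)]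
      exact hvl.norm_sub_le_of_subgradient hκ hp ht.1 hts hs.2
    · rw [abs_sub_comm, abs_of_nonneg (sub_nonneg.2 hst), norm_sub_rev]
      exact hvl.norm_sub_le_of_subgradient hκ hp hs.1 hst ht.2
  refine ⟨η / 3 / (L + 1), by positivity, fun s hs hst => ?_⟩
  rw [Real.dist_eq, lt_div_iff₀ (by positivity)] at hst
  have h1 := huv s hs
  have h2 := huv t ht
  rw [norm_sub_rev] at h2
  have h3 := hlip s hs
  rw [dist_eq_norm]
  calc ‖u s - u t‖ = ‖(u s - v s) + (v s - v t) + (v t - u t)‖ := by congr 1; abel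
    _ ≤ _ := norm_add₃_le
    _ < η := by linarith [abs_nonneg (s - t)]

/-- Away from the initial time an Euler limit is Lipschitz and satisfies an integrated evolution
variational inequality. -/
theorem exists_lipschitz_and_evi (h : IsClosedSemiconvex C φ κ) (hκ : 0 ≤ κ) {x : H}
    (hx : x ∈ closure C) {u : ℝ → H} (hu : IsEulerLimit C φ κ x u) {τ T : ℝ} (hτ : 0 < τ)
    (hT : 0 ≤ T) :
    ∃ K, 0 ≤ K ∧ ∀ s t, τ ≤ s → s ≤ t → t ≤ T → ‖u t - u s‖ ≤ K * (t - s) ∧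
      (s < t → ∀ v ∈ C, u t ∈ C ∧ φ (u t) ≤ (‖u s - v‖ ^ 2 - ‖u t - v‖ ^ 2) / (2 * (t - s)) +
        φ v + κ / 2 * (‖u t - v‖ + K * (t - s)) ^ 2) := by
  obtain ⟨W, hW, hlim⟩ := hu
  -- The velocity bound is taken from time `τ / 2` because the grid time `⌊s/ε⌋ ε` may fall below `s
  -- ≥ τ` by as much as `ε ≤ τ / 2`.
  obtain ⟨K, hK0, hK⟩ := h.exists_norm_eulerOrbit_succ_sub_le hκ hx hW (half_pos hτ) hT
  refine ⟨K, hK0, fun s t hs hst ht => ?_⟩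
  have h0s : 0 ≤ s := hτ.le.trans hs
  have h0t : 0 ≤ t := h0s.trans hst
  have hd : Tendsto (fun ε : ℝ => (⌊t / ε⌋₊ : ℝ) * ε - (⌊s / ε⌋₊ : ℝ) * ε) (𝓝[>] 0)
      (𝓝 (t - s)) := (tendsto_floor_div_mul h0t).sub (tendsto_floor_div_mul h0s)
  have hstep : ∀ᶠ ε in 𝓝[>] (0 : ℝ), ∀ k, ⌊s / ε⌋₊ ≤ k → k ≤ ⌊t / ε⌋₊ →
      ‖W ε (k + 1) - W ε k‖ ≤ K * ε := by
    filter_upwards [hK, eventually_step_small κ (half_pos hτ)] with ε hKε hε k hk hk'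
    have hε0 := hε.1
    have h1 : (⌊s / ε⌋₊ : ℝ) * ε ≤ k * ε := by gcongr
    have h2 : (k : ℝ) * ε ≤ ⌊t / ε⌋₊ * ε := by gcongr
    have h3 := floor_div_mul_le h0t hε0
    have h4 := sub_le_floor_div_mul s hε0
    exact hKε k (by linarith [hε.2.2]) (by linarith)
  have hfl : ∀ ε > (0 : ℝ), ⌊s / ε⌋₊ ≤ ⌊t / ε⌋₊ := fun ε hε => Nat.floor_le_floor (by gcongr)
  refine ⟨?_, fun hst' v hv => ?_⟩
  · refine le_of_tendsto_of_tendsto ((hlim t h0t).sub (hlim s h0s)).norm (hd.const_mul K) ?_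
    filter_upwards [hstep, self_mem_nhdsWithin] with ε hε hε0
    refine (norm_sub_le_mul_of_forall_succ (hfl ε hε0) (s := K * ε)
      fun k hk hk' => hε k hk hk'.le).trans (le_of_eq (by ring))
  · have hts : 0 < t - s := sub_pos.2 hst'
    have hc : Tendsto (fun ε : ℝ => (‖W ε ⌊s / ε⌋₊ - v‖ ^ 2 - ‖W ε ⌊t / ε⌋₊ - v‖ ^ 2) /
        (2 * ((⌊t / ε⌋₊ : ℝ) * ε - (⌊s / ε⌋₊ : ℝ) * ε)) + φ v + κ / 2 *
        (‖W ε ⌊t / ε⌋₊ - v‖ + K * ((⌊t / ε⌋₊ : ℝ) * ε - (⌊s / ε⌋₊ : ℝ) * ε)) ^ 2) (𝓝[>] 0)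
        (𝓝 ((‖u s - v‖ ^ 2 - ‖u t - v‖ ^ 2) / (2 * (t - s)) + φ v +
          κ / 2 * (‖u t - v‖ + K * (t - s)) ^ 2)) := by
      have h1 := ((hlim s h0s).sub_const v).norm
      have h2 := ((hlim t h0t).sub_const v).norm
      exact ((((h1.pow 2).sub (h2.pow 2)).div (hd.const_mul 2) (by positivity)).add_const _).add
        (((h2.add (hd.const_mul K)).pow 2).const_mul _)
    refine h.mem_and_le_of_tendsto ?_ (hlim t h0t) hc
    filter_upwards [hW, hstep, eventually_step_small κ (half_pos hτ),
      hd.eventually (lt_mem_nhds hts)] with ε hWε hε hεs hdε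
    have hε0 := hεs.1
    set m := ⌊s / ε⌋₊
    set n := ⌊t / ε⌋₊
    have hn : 1 ≤ n := by
      by_contra! hcon
      have hn0 : n = 0 := by lia
      have hm0 : m = 0 := by
        have := hfl ε hε0
        lia
      simp [hn0, hm0] at hdε
    refine ⟨by obtain ⟨i, hi⟩ := Nat.exists_eq_add_of_le' hn; rw [hi]; exact (hWε.2 i).1, ?_⟩
    -- The radius `ρ` is the final distance to `v` plus the largest drift between grid times `mε`
    -- and `nε` at speed `K`.
    have h1 := hWε.2.sq_norm_sub_le_of_le hκ hε0 (by nlinarith [mul_nonneg hκ hε0.le]) hv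
      (hfl ε hε0) (ρ := ‖W ε n - v‖ + K * (n * ε - m * ε)) (fun k hk hk' => ?_)
    · have h2 : (‖W ε m - v‖ ^ 2 - ‖W ε n - v‖ ^ 2) / (2 * (n * ε - m * ε)) * (n * ε - m * ε) =
          (‖W ε m - v‖ ^ 2 - ‖W ε n - v‖ ^ 2) / 2 := by
        rw [div_mul_eq_mul_div, div_eq_div_iff (by positivity) two_ne_zero]
        ring
      refine le_of_mul_le_mul_right ?_ hdε
      rw [add_mul, add_mul, h2]
      linarith
    · have h3 := norm_sub_le_mul_of_forall_succ hk' (X := W ε) (s := K * ε)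
        fun i hi hi' => hε i (hk.trans hi) hi'.le
      have h4 : ((n : ℝ) - k) * (K * ε) ≤ K * (n * ε - m * ε) := by
        have h5 : (m : ℝ) ≤ k := by exact_mod_cast hk
        nlinarith [mul_nonneg hK0 hε0.le]
      calc ‖W ε k - v‖ = ‖(W ε n - v) - (W ε n - W ε k)‖ := by congr 1; abel
        _ ≤ ‖W ε n - v‖ + ‖W ε n - W ε k‖ := _root_.norm_sub_le _ _
        _ ≤ _ := by gcongr; exact h3.trans h4

/-- As `s ↑ t` in the integrated variational inequality, the difference quotient of `‖u - v‖² / 2`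
tends to the pairing of `u'` with `u t - v`, and the drift `K (t - s)` disappears. -/
theorem isSemisubgradient_of_hasDerivAt (h : IsClosedSemiconvex C φ κ) (hκ : 0 ≤ κ) {x : H}
    (hx : x ∈ closure C) {u : ℝ → H} (hu : IsEulerLimit C φ κ x u) {t : ℝ} (ht : 0 < t) {u' : H}
    (hd : HasDerivAt u u' t) : IsSemisubgradient C φ κ (u t) (-u') := by
  obtain ⟨K, hK0, hK⟩ := hu.exists_lipschitz_and_evi h hκ hx (half_pos ht) ht.le
  have hmem : ∀ᶠ s in 𝓝[<] t, t / 2 ≤ s ∧ s < t :=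
    eventually_of_mem (Ico_mem_nhdsLT (half_lt_self ht)) fun s hs => hs
  obtain ⟨v₀, hv₀⟩ := h.nonempty
  obtain ⟨s₀, hs₀⟩ := hmem.exists
  refine ⟨((hK s₀ t hs₀.1 hs₀.2.le le_rfl).2 hs₀.2 v₀ hv₀).1, fun v hv => ?_⟩
  have h1 : HasDerivAt (fun s => ‖u s - v‖ ^ 2) (2 * ⟪u t - v, u'⟫) t :=
    (hd.sub_const v).norm_sq
  have h2 : Tendsto (fun s => (‖u s - v‖ ^ 2 - ‖u t - v‖ ^ 2) / (2 * (t - s))) (𝓝[<] t)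
      (𝓝 (-⟪u t - v, u'⟫)) := by
    have h3 := ((hasDerivAt_iff_tendsto_slope.1 h1).mono_left
      (nhdsWithin_mono t fun s (hs : s < t) => hs.ne)).const_mul (-1 / 2 : ℝ)
    rw [show -1 / 2 * (2 * ⟪u t - v, u'⟫) = -⟪u t - v, u'⟫ by ring] at h3
    refine h3.congr' ?_
    filter_upwards [self_mem_nhdsWithin] with s hs
    have h4 : s - t ≠ 0 := sub_ne_zero.2 (ne_of_lt hs)
    have h5 : t - s ≠ 0 := sub_ne_zero.2 (ne_of_gt hs)
    rw [slope_def_field]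
    field_simp
    ring
  have h6 : Tendsto (fun s => κ / 2 * (‖u t - v‖ + K * (t - s)) ^ 2) (𝓝[<] t)
      (𝓝 (κ / 2 * ‖u t - v‖ ^ 2)) := by
    refine tendsto_nhdsWithin_of_tendsto_nhds ?_
    simpa using (Continuous.tendsto (f := fun s : ℝ => κ / 2 * (‖u t - v‖ + K * (t - s)) ^ 2)
      (by fun_prop) t)
  have h7 := ge_of_tendsto ((h2.add_const (φ v)).add h6)
    (hmem.mono fun s hs => ((hK s t hs.1 hs.2.le le_rfl).2 hs.2 v hv).2)
  rw [norm_sub_rev v, inner_neg_left, ← neg_sub (u t) v, inner_neg_right, neg_neg,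
    real_inner_comm]
  linarith

end IsEulerLimit

end EulerLimits

/-! ### From real-valued semiconvex functionals to `J`, and the generation theorem. -/

section GradientFlow

theorem AbsolutelyContinuousOnInterval.norm_sq {E : Type*}
    [NormedAddCommGroup E] {f : ℝ → E} {a b : ℝ}
    (hf : AbsolutelyContinuousOnInterval f a b) :
    AbsolutelyContinuousOnInterval (fun t => ‖f t‖ ^ 2) a b := by
  obtain ⟨K, hK⟩ := hf.exists_bound
  unfold AbsolutelyContinuousOnInterval at hf ⊢
  refine squeeze_zero' (Eventually.of_forall fun _ => Finset.sum_nonneg fun _ _ => dist_nonneg) ?_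
    (by simpa using hf.const_mul (2 * K))
  rw [eventually_inf_principal]
  filter_upwards with I hI
  rw [Finset.mul_sum]
  refine Finset.sum_le_sum fun i hi => ?_
  have h1 := hK _ (hI.1 i hi).1
  have h2 := hK _ (hI.1 i hi).2
  have h3 := abs_norm_sub_norm_le (f (I.2 i).1) (f (I.2 i).2)
  rw [Real.dist_eq, dist_eq_norm, sq_sub_sq, abs_mul, abs_of_nonneg (by positivity)]
  exact mul_le_mul (by linarith) h3 (abs_nonneg _) (by linarith [norm_nonneg (f (I.2 i).1)])

theorem coe_toReal_of_mem_effDomain {α : Type*} {J : α → EReal} (hbot : ∀ w, J w ≠ ⊥) {w : α}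
    (hw : w ∈ effDomain J) : (((J w).toReal : ℝ) : EReal) = J w :=
  EReal.coe_toReal (ne_of_lt hw) (hbot w)

theorem eq_top_of_notMem_effDomain {α : Type*} {J : α → EReal} {w : α} (hw : w ∉ effDomain J) :
    J w = ⊤ :=
  top_le_iff.1 (not_lt.1 hw)

variable {H : Type*} [NormedAddCommGroup H] [InnerProductSpace ℝ H]
variable {J : H → EReal} {lam κ : ℝ}

theorem IsLambdaConvex.segment (hJ : IsLambdaConvex lam J) (hbot : ∀ w, J w ≠ ⊥) {x y : H}
    (hx : x ∈ effDomain J) (hy : y ∈ effDomain J) {t : ℝ} (ht : t ∈ Icc (0 : ℝ) 1) :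
    (1 - t) • x + t • y ∈ effDomain J ∧ (J ((1 - t) • x + t • y)).toReal ≤
      (1 - t) * (J x).toReal + t * (J y).toReal - lam / 2 * t * (1 - t) * ‖x - y‖ ^ 2 := by
  have h1 := hJ x hx y hy t ht
  rw [← coe_toReal_of_mem_effDomain hbot hx, ← coe_toReal_of_mem_effDomain hbot hy] at h1
  norm_cast at h1
  have h2 : (1 - t) • x + t • y ∈ effDomain J := h1.trans_lt (EReal.coe_lt_top _)
  refine ⟨h2, ?_⟩
  rw [← coe_toReal_of_mem_effDomain hbot h2] at h1
  exact_mod_cast h1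

theorem isClosedSemiconvex_effDomain (hproper : IsProperFunctional J)
    (hlsc : LowerSemicontinuous J) (hconv : IsLambdaConvex lam J) (hκ : -lam ≤ κ) :
    IsClosedSemiconvex (effDomain J) (fun w => (J w).toReal) κ where
  nonempty := hproper.2
  segment_mem x hx y hy t ht := (hconv.segment hproper.1 hx hy ht).1
  segment_le x hx y hy t ht := by
    refine (hconv.segment hproper.1 hx hy ht).2.trans ?_
    have h1 : 0 ≤ (lam + κ) / 2 * t * (1 - t) * ‖x - y‖ ^ 2 :=
      mul_nonneg (mul_nonneg (mul_nonneg (by linarith) ht.1) (by linarith [ht.2])) (sq_nonneg _)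
    linarith
  isClosed_sublevel c := by
    convert hlsc.isClosed_preimage (c : EReal) using 1
    ext w
    simp only [mem_ofPred_eq, mem_preimage, mem_Iic]
    constructor
    · rintro ⟨hw, hwc⟩
      rw [← coe_toReal_of_mem_effDomain hproper.1 hw]
      exact_mod_cast hwc
    · intro hw
      have hw' : w ∈ effDomain J := hw.trans_lt (EReal.coe_lt_top c)
      refine ⟨hw', ?_⟩
      rw [← coe_toReal_of_mem_effDomain hproper.1 hw'] at hw
      exact_mod_cast hw

/-- The quadratic error is `o(‖v - w‖)`. -/
theorem IsSemisubgradient.mem_frechetSubdifferential (hbot : ∀ w, J w ≠ ⊥) {w p : H}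
    (hp : IsSemisubgradient (effDomain J) (fun w => (J w).toReal) κ w p) :
    p ∈ frechetSubdifferential J w := by
  refine ⟨hp.1, fun η hη => ?_⟩
  have h1 : ∀ᶠ v in 𝓝 w, κ / 2 * ‖v - w‖ < η := by
    have : Tendsto (fun v => κ / 2 * ‖v - w‖) (𝓝 w) (𝓝 0) :=
      Continuous.tendsto' (by fun_prop) _ _ (by simp)
    exact this.eventually (gt_mem_nhds hη)
  filter_upwards [h1] with v hv
  by_cases hvJ : v ∈ effDomain J
  · rw [← coe_toReal_of_mem_effDomain hbot hp.1, ← coe_toReal_of_mem_effDomain hbot hvJ]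
    have h2 := hp.2 v hvJ
    have h3 := mul_le_mul_of_nonneg_right hv.le (norm_nonneg (v - w))
    norm_cast
    linarith
  · rw [eq_top_of_notMem_effDomain hvJ]
    exact le_top

/-- Convexity along the segment from `w` to `v` makes the local inequality global. The constant is
exactly `-lam`, of either sign, as the sharp contraction rate requires. -/
theorem IsLambdaConvex.isSemisubgradient (hconv : IsLambdaConvex lam J) (hbot : ∀ w, J w ≠ ⊥)
    {w p : H} (hp : p ∈ frechetSubdifferential J w) :
    IsSemisubgradient (effDomain J) (fun w => (J w).toReal) (-lam) w p := by
  refine ⟨hp.1, fun v hv => ?_⟩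
  have key : ∀ η > (0 : ℝ), (J w).toReal + ⟪p, v - w⟫ - η * ‖v - w‖ ≤
      (J v).toReal + -lam / 2 * ‖v - w‖ ^ 2 := by
    intro η hη
    have h1 : Tendsto (fun t : ℝ => (1 - t) • w + t • v) (𝓝[>] 0) (𝓝 w) :=
      tendsto_nhdsWithin_of_tendsto_nhds (Continuous.tendsto' (by fun_prop) _ _ (by simp))
    have h2 : Tendsto (fun t : ℝ => (J v).toReal + -lam / 2 * (1 - t) * ‖v - w‖ ^ 2) (𝓝[>] 0)
        (𝓝 ((J v).toReal + -lam / 2 * ‖v - w‖ ^ 2)) :=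
      tendsto_nhdsWithin_of_tendsto_nhds (Continuous.tendsto' (by fun_prop) _ _ (by simp))
    refine ge_of_tendsto h2 ?_
    filter_upwards [h1.eventually (hp.2 η hη), Ioc_mem_nhdsGT one_pos] with t ht htI
    obtain ⟨h3, h4⟩ := hconv.segment hbot hp.1 hv (t := t) ⟨htI.1.le, htI.2⟩
    rw [← coe_toReal_of_mem_effDomain hbot hp.1, ← coe_toReal_of_mem_effDomain hbot h3,
      show (1 - t) • w + t • v - w = t • (v - w) by module, inner_smul_right, norm_smul,
      Real.norm_of_nonneg htI.1.le] at ht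
    norm_cast at ht
    rw [norm_sub_rev w v] at h4
    refine le_of_mul_le_mul_left ?_ htI.1
    linarith
  have h5 : Tendsto (fun η : ℝ => (J w).toReal + ⟪p, v - w⟫ - η * ‖v - w‖) (𝓝[>] 0)
      (𝓝 ((J w).toReal + ⟪p, v - w⟫)) :=
    tendsto_nhdsWithin_of_tendsto_nhds (Continuous.tendsto' (by fun_prop) _ _ (by simp))
  exact le_of_tendsto h5 (eventually_of_mem self_mem_nhdsWithin key)

theorem isImplicitEuler_of_forall_le (hbot : ∀ w, J w ≠ ⊥) {ε : ℝ} {x : H} {W : ℕ → H}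
    (h0 : W 0 = x) (hW : ∀ n, W (n + 1) ∈ effDomain J ∧ ∀ v ∈ effDomain J,
      (J (W (n + 1))).toReal + ‖W (n + 1) - W n‖ ^ 2 / (2 * ε) ≤
        (J v).toReal + ‖v - W n‖ ^ 2 / (2 * ε)) : IsImplicitEuler J ε x W := by
  refine ⟨h0, fun n v _ => ?_⟩
  obtain ⟨h1, h2⟩ := hW n
  show J (W (n + 1)) + _ ≤ J v + _
  by_cases hv : v ∈ effDomain J
  · rw [← coe_toReal_of_mem_effDomain hbot h1, ← coe_toReal_of_mem_effDomain hbot hv]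
    exact_mod_cast h2 v hv
  · rw [eq_top_of_notMem_effDomain hv, EReal.top_add_coe]
    exact le_top

theorem IsImplicitEuler.isEulerOrbit (hbot : ∀ w, J w ≠ ⊥)
    (h : IsClosedSemiconvex (effDomain J) (fun w => (J w).toReal) κ) {ε : ℝ} {x : H} {W : ℕ → H}
    (hW : IsImplicitEuler J ε x W) :
    IsEulerOrbit (effDomain J) (fun w => (J w).toReal) κ ε W := by
  intro n
  have h1 : ∀ v, J (W (n + 1)) + ((‖W (n + 1) - W n‖ ^ 2 / (2 * ε) : ℝ) : EReal) ≤
      J v + ((‖v - W n‖ ^ 2 / (2 * ε) : ℝ) : EReal) := fun v => hW.2 n (mem_univ v)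
  have h2 : W (n + 1) ∈ effDomain J := by
    obtain ⟨v, hv⟩ := h.nonempty
    have h3 := h1 v
    by_contra hcon
    rw [eq_top_of_notMem_effDomain hcon, EReal.top_add_coe,
      ← coe_toReal_of_mem_effDomain hbot hv] at h3
    norm_cast at h3
  refine h.isSemisubgradient_of_forall_le h2 fun v hv => ?_
  have h3 := h1 v
  rw [← coe_toReal_of_mem_effDomain hbot h2, ← coe_toReal_of_mem_effDomain hbot hv] at h3
  exact_mod_cast h3

/-- Two solutions of the gradient flow of a `lam`-convex functional contract at rate `lam`. -/
theorem IsGradientFlowSolution.norm_sub_le (hconv : IsLambdaConvex lam J)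
    (hbot : ∀ w, J w ≠ ⊥) {T : ℝ} (hT : 0 < T) {x y : H} {u v : ℝ → H}
    (hu : IsGradientFlowSolution J T x u) (hv : IsGradientFlowSolution J T y v) {t : ℝ}
    (ht : t ∈ Icc 0 T) : ‖u t - v t‖ ≤ Real.exp (-lam * t) * ‖x - y‖ := by
  obtain ⟨huc, hua, hud, hu0⟩ := hu
  obtain ⟨hvc, hva, hvd, hv0⟩ := hv
  -- Quasi-monotonicity with constant `-lam` makes `deriv g ≤ 0` almost everywhere. Absolute
  -- continuity holds only inside `(0, T)`, so the endpoints are reached by continuity.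
  set g : ℝ → ℝ := fun t => Real.exp (2 * lam * t) * ‖u t - v t‖ ^ 2 with hg
  have hgc : ContinuousOn g (Icc 0 T) :=
    (Continuous.continuousOn (by fun_prop)).mul ((huc.sub hvc).norm.pow 2)
  have hgd : ∀ᵐ t ∂(volume.restrict (Ioo 0 T)), deriv g t ≤ 0 := by
    filter_upwards [hud, hvd] with t hut hvt
    obtain ⟨u', hu', hup⟩ := hut
    obtain ⟨v', hv', hvp⟩ := hvt
    have h1 : HasDerivAt (fun t => Real.exp (2 * lam * t))
        (Real.exp (2 * lam * t) * (2 * lam)) t := by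
      simpa using ((hasDerivAt_id t).const_mul (2 * lam)).exp
    have h2 := h1.mul (hu'.sub hv').norm_sq
    have h3 := (hconv.isSemisubgradient hbot hup).neg_le_inner (hconv.isSemisubgradient hbot hvp)
    rw [← neg_add', ← sub_eq_add_neg, inner_neg_left, real_inner_comm] at h3
    have h4 : deriv g t = _ := h2.deriv
    rw [h4]
    have h5 := mul_le_mul_of_nonneg_left h3 (Real.exp_pos (2 * lam * t)).le
    simp only [Pi.sub_apply]
    linarith
  have hanti : ∀ a b, 0 < a → a ≤ b → b < T → g b ≤ g a := by
    intro a b ha hab hb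
    have h1 : AbsolutelyContinuousOnInterval (fun t => Real.exp (2 * lam * t)) a b :=
      ContDiffOn.absolutelyContinuousOnInterval (ContDiff.contDiffOn (by fun_prop))
    have h2 : AbsolutelyContinuousOnInterval g a b :=
      h1.mul ((hua a b ha hab hb).sub (hva a b ha hab hb)).norm_sq
    have h3 : ∫ s in a..b, deriv g s ≤ 0 := by
      rw [intervalIntegral.integral_of_le hab]
      refine integral_nonpos_of_ae ?_
      exact ae_restrict_of_ae_restrict_of_subset
        (fun s (hs : s ∈ Ioc a b) => mem_Ioo.2 ⟨ha.trans hs.1, hs.2.trans_lt hb⟩) hgd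
    linarith [h2.integral_deriv_eq_sub]
  have hIoo : ∀ b ∈ Ioo 0 T, g b ≤ g 0 := by
    intro b hb
    have h1 : Tendsto g (𝓝[>] 0) (𝓝 (g 0)) := by
      have := (hgc 0 ⟨le_rfl, hT.le⟩).mono Ioo_subset_Icc_self
      rwa [ContinuousWithinAt, nhdsWithin_Ioo_eq_nhdsGT hT] at this
    exact ge_of_tendsto h1 (eventually_of_mem (Ioc_mem_nhdsGT hb.1)
      fun a ha => hanti a b ha.1 ha.2 hb.2)
  have hgt : g t ≤ g 0 := by
    have h1 : Tendsto g (𝓝[Ioo 0 T] t) (𝓝 (g t)) := (hgc t ht).mono Ioo_subset_Icc_self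
    have : (𝓝[Ioo 0 T] t).NeBot := by
      rw [← mem_closure_iff_nhdsWithin_neBot, closure_Ioo hT.ne]
      exact ht
    exact le_of_tendsto h1 (eventually_of_mem self_mem_nhdsWithin hIoo)
  simp only [hg, hu0, hv0, mul_zero, Real.exp_zero, one_mul] at hgt
  refine le_of_sq_le_sq ?_ (by positivity)
  have h6 : Real.exp (-lam * t) ^ 2 * Real.exp (2 * lam * t) = 1 := by
    rw [← Real.exp_nat_mul, ← Real.exp_add, Real.exp_eq_one_iff]
    push_cast
    ring
  calc ‖u t - v t‖ ^ 2 = Real.exp (-lam * t) ^ 2 * (Real.exp (2 * lam * t) * ‖u t - v t‖ ^ 2) := by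
        rw [← mul_assoc, h6, one_mul]
    _ ≤ Real.exp (-lam * t) ^ 2 * ‖x - y‖ ^ 2 := by gcongr
    _ = _ := by ring

variable [CompleteSpace H] [SeparableSpace H]

theorem IsEulerLimit.isGradientFlowSolution (hbot : ∀ w, J w ≠ ⊥)
    (h : IsClosedSemiconvex (effDomain J) (fun w => (J w).toReal) κ) (hκ : 0 ≤ κ) {x : H}
    (hx : x ∈ closure (effDomain J)) {u : ℝ → H}
    (hu : IsEulerLimit (effDomain J) (fun w => (J w).toReal) κ x u) (T : ℝ) :
    IsGradientFlowSolution J T x u := by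
  have hlip : ∀ a b : ℝ, 0 < a → a ≤ b → ∃ K, LipschitzOnWith K u (Icc a b) := by
    intro a b ha hab
    obtain ⟨K, hK0, hK⟩ := hu.exists_lipschitz_and_evi h hκ hx ha (ha.le.trans hab)
    refine ⟨⟨K, hK0⟩, LipschitzOnWith.of_dist_le_mul fun t ht s hs => ?_⟩
    rw [dist_eq_norm, Real.dist_eq]
    rcases le_total s t with hst | hst
    · rw [abs_of_nonneg (sub_nonneg.2 hst)]
      exact (hK s t hs.1 hst ht.2).1
    · rw [abs_sub_comm, abs_of_nonneg (sub_nonneg.2 hst), norm_sub_rev]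
      exact (hK t s ht.1 hst hs.2).1
  refine ⟨hu.continuousOn h hκ hx T, fun a b ha hab _ => ?_, ?_, hu.apply_zero⟩
  · obtain ⟨K, hK⟩ := hlip a b ha hab
    rw [← uIcc_of_le hab] at hK
    exact hK.absolutelyContinuousOnInterval
  -- The Lipschitz constant may blow up at `0`, so `(0, T)` is exhausted by the intervals `(1/(n+1),
  -- T)`.
  · have hd : ∀ n : ℕ, ∀ᵐ t, t ∈ Ioo (1 / ((n : ℝ) + 1)) T → DifferentiableAt ℝ u t := by
      intro n
      rcases le_total (1 / ((n : ℝ) + 1)) T with hn | hn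
      · obtain ⟨K, hK⟩ := hlip _ T (by positivity) hn
        exact hK.ae_differentiableAt_of_separable hn
      · exact Eventually.of_forall fun t ht => absurd (ht.1.trans ht.2) (not_lt.2 hn)
    rw [ae_restrict_iff' measurableSet_Ioo]
    filter_upwards [ae_all_iff.2 hd] with t ht htT
    obtain ⟨n, hn⟩ := exists_nat_one_div_lt htT.1
    have h1 := (ht n ⟨hn, htT.2⟩).hasDerivAt
    exact ⟨_, h1, (hu.isSemisubgradient_of_hasDerivAt h hκ hx htT.1 h1).mem_frechetSubdifferential
      hbot⟩

/-- Generation theorem for gradient flows of `lam`-convex functionals on a Hilbert space. -/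
theorem exists_unique_minimizingMovement_and_gradientFlow {T : ℝ} (hT : 0 < T)
    (hproper : IsProperFunctional J) (hlsc : LowerSemicontinuous J)
    (hconv : IsLambdaConvex lam J) {x : H} (hx : x ∈ closure (effDomain J)) :
    ∃ u : ℝ → H, (IsMinimizingMovement J T x u ∧
        ∀ v : ℝ → H, IsMinimizingMovement J T x v → EqOn v u (Icc 0 T)) ∧
      (IsGradientFlowSolution J T x u ∧
        ∀ v : ℝ → H, IsGradientFlowSolution J T x v → EqOn v u (Icc 0 T)) := by
  have hκ : 0 ≤ max (-lam) 0 := le_max_right _ _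
  have h := isClosedSemiconvex_effDomain hproper hlsc hconv (le_max_left (-lam) 0)
  obtain ⟨W, hW⟩ := h.exists_eulerOrbit_family hκ x
  have hW' := hW.mono fun ε hε => And.intro hε.1 hε.2.1
  obtain ⟨u, hu⟩ := h.exists_isEulerLimit hκ hx hW'
  have hgf := IsEulerLimit.isGradientFlowSolution hproper.1 h hκ hx ⟨W, hW', hu⟩ T
  refine ⟨u, ⟨⟨W, ?_, fun t ht => hu t ht.1⟩, fun v hv t ht => ?_⟩, hgf, fun v hv t ht => ?_⟩
  · exact hW.mono fun ε hε => isImplicitEuler_of_forall_le hproper.1 hε.1 hε.2.2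
  · obtain ⟨V, hV, hVlim⟩ := hv
    refine tendsto_nhds_unique (hVlim t ht) ((hu t ht.1).congr' ?_)
    filter_upwards [hW', hV, eventually_step_small (max (-lam) 0) one_pos] with ε hWε hVε hε
    -- Equal starting points and the contraction force the two schemes to coincide at this step
    -- size.
    have h1 := hWε.2.norm_sub_le hκ hε.1 hε.2.1 (hVε.isEulerOrbit hproper.1 h)
      (floor_div_mul_le ht.1 hε.1)
    rw [hWε.1, hVε.1, sub_self, norm_zero, mul_zero] at h1
    exact sub_eq_zero.1 (norm_le_zero_iff.1 h1)
  · have h1 := hv.norm_sub_le hconv hproper.1 hT hgf ht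
    rw [sub_self, norm_zero, mul_zero] at h1
    exact sub_eq_zero.1 (norm_le_zero_iff.1 h1)

end GradientFlow

/-! ### Application to `L²(D)`. -/

theorem theorem3p9 {d : ℕ} (D : Opens (EuclideanSpace ℝ (Fin d)))
    (hD : Bornology.IsBounded (D : Set (EuclideanSpace ℝ (Fin d))))
    (T : ℝ) (hT : 0 < T) (lam : ℝ) (J : L2Space D → EReal)
    (hJX : effDomain J ⊆ capacitaryRepresentatives D)
    (hJproper : IsProperFunctional J)
    (hJlsc : LowerSemicontinuous J)
    (hJconv : IsLambdaConvex lam J) :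
    ∃ S : L2Space D → ℝ → L2Space D,
      (∀ w₀ ∈ closure (effDomain J),
        (IsMinimizingMovement J T w₀ (S w₀) ∧
          ∀ u : ℝ → L2Space D, IsMinimizingMovement J T w₀ u → EqOn u (S w₀) (Icc 0 T)) ∧
        (IsGradientFlowSolution J T w₀ (S w₀) ∧
          ∀ u : ℝ → L2Space D, IsGradientFlowSolution J T w₀ u → EqOn u (S w₀) (Icc 0 T))) ∧
      ∀ w₀ ∈ closure (effDomain J), ∀ v₀ ∈ closure (effDomain J), ∀ t ∈ Icc (0 : ℝ) T,
        ‖S w₀ t - S v₀ t‖ ≤ Real.exp (-lam * t) * ‖w₀ - v₀‖ := by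
  -- Finiteness of the exponent is needed by instance search for the separability of `L²(D)`.
  have : Fact ((2 : ℝ≥0∞) ≠ ⊤) := ⟨by simp⟩
  choose! S hS using fun w₀ (hw₀ : w₀ ∈ closure (effDomain J)) =>
    exists_unique_minimizingMovement_and_gradientFlow hT hJproper hJlsc hJconv hw₀
  exact ⟨S, hS, fun w₀ hw₀ v₀ hv₀ t ht =>
    (hS w₀ hw₀).2.1.norm_sub_le hJconv hJproper.1 hT (hS v₀ hv₀).2.1 ht⟩
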